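/- **Conventions.** Graphs are finite and connected, have no vertices of valence one, and may have vertices of valence two; the *topological edges* of a graph are the edges of the graph obtained by forgetting the valence-two vertices. A *train track map* $f:\Gamma\to\Gamma$ sends vertices to vertices and edges across edge paths, and every power $f^k$, $k\ge 1$, is locally injective on the interior of every edge. It is *expanding irreducible* if its transition matrix $A=(a_{ij})$ ($a_{ij}$ is the number of times that $f(e_i)$ crosses $e_j$) is irreducible with leading eigenvalue $\lambda>1$; the *eigenmetric* on $\Gamma$ is the positive vector $\ell$ of edge lengths with $A\ell=\lambda\ell$ and total length one. An *illegal turn* is a pair of distinct directions at one vertex that some $Df^k$, $k\ge1$, identifies. Outer space $CV_N$ is the space of equivalence classes of marked metric graphs of volume one with marking $\iota:R_N\to\Gamma$, with the length function topology. For an automorphism $\varphi$ of $F_N$ let $TT(\varphi)\subseteq CV_N$ be the set of marked metric graphs that carry a train track map representing $\varphi$ (that is, $f\iota\simeq\iota\varphi$) and stretching every edge by one and the same factor $\lambda>1$, and let the *axis bundle* $\mathcal A_\varphi$ be the closure in $CV_N$ of $\bigcup_{k\ge1}TT(\varphi^k)$. We say that $\mathcal A_\varphi$ *has local dimension at least $k$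 at $\Gamma$* if every neighborhood of $\Gamma$ in $CV_N$ contains an embedded copy of $\mathbb R^k$ which lies in $\mathcal A_\varphi$. **Lemma.** Let $f:\Gamma\to\Gamma$ be an expanding irreducible train track map on a marked graph representing $\varphi:F_N\to F_N$, and give $\Gamma$ the eigenmetric induced by $f$, so that $\Gamma\in CV_N$. Suppose that 1. $\Gamma$ has $n$ illegal turns $\tau_1,\dots,\tau_n$, occurring at distinct valence-three vertices $v_1,\dots,v_n$; 2. some topological edge of $\Gamma$ is not incident to any $v_i$. Then every neighborhood of $\Gamma$ in $CV_N$ contains an embedded copy of $\mathbb R^n$ which is contained in $\mathcal A_\varphi$; more precisely, for some $\varepsilon>0$ the set of all marked metric graphs obtained from $\Gamma$ by simultaneously folding each turn $\tau_i$ by a length $t_i\in(0,\varepsilon)$ and then rescaling to volume one is such a copy. In particular, $\mathcal A_\varphi$ has local dimension at least $n$ at $\Gamma$. If assumption (2) is dropped, then $\mathcal A_\varphi$ still has local dimension at least $n-2$ at $\Gamma$. -/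

import Mathlib

open Topology

namespace AxisBundle

/-! ### Finite graphs, edge paths, graph maps -/

/-- A finite graph, loops and multiple edges allowed. Every edge carries an arbitrary reference
orientation from `src e` to `tgt e`. The oriented edges are the pairs `(e, b) : E × Bool`, where
`(e, true)` is `e` with its reference orientation and `(e, false)` is `e` reversed. -/
structure FinGraph where
  V : Type
  E : Type
  [fintypeV : Fintype V]
  [fintypeE : Fintype E]
  [decEqV : DecidableEq V]
  [decEqE : DecidableEq E]
  src : E → V
  tgt : E → V

attribute [instance] FinGraph.fintypeV FinGraph.fintypeE FinGraph.decEqV FinGraph.decEqE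

namespace FinGraph

variable (G : FinGraph)

/-- Oriented edges; also the directions of `G`, the germ at the initial vertex being meant. -/
abbrev Dir : Type := G.E × Bool

variable {G}

/-- The same edge with the opposite orientation. -/
def rev (d : G.Dir) : G.Dir := (d.1, !d.2)

/-- Initial vertex of an oriented edge. -/
def init (d : G.Dir) : G.V := if d.2 then G.src d.1 else G.tgt d.1

/-- Terminal vertex of an oriented edge. -/
def term (d : G.Dir) : G.V := init (rev d)

/-- `IsPath u w p`: the list `p` of oriented edges is an edge path from `u` to `w`. -/
def IsPath : G.V → G.V → List G.Dir → Prop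
  | u, w, [] => u = w
  | u, w, d :: p => init d = u ∧ IsPath (term d) w p

/-- The number of directions at a vertex (a loop contributes two). -/
def valence (v : G.V) : ℕ := Fintype.card {d : G.Dir // init d = v}

variable (G) in
/-- Nonempty and path connected. -/
def IsConnected : Prop := Nonempty G.V ∧ ∀ u w : G.V, ∃ p, IsPath u w p

/-- `d'` continues `d` through a vertex of valence two, without turning back. -/
def Continues (d d' : G.Dir) : Prop :=
  init d' = term d ∧ valence (term d) = 2 ∧ d' ≠ rev d

/-- For a vertex `v` of valence other than two: `v` is an endpoint of the topological edge that
contains `e`. The topological edges are the edges of the graph obtained by forgetting all vertices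
of valence two; one reaches their endpoints from `e`, in either direction, by going straight on
through vertices of valence two. If there is no vertex of valence two, this says that `v` is
`src e` or `tgt e`. -/
def TopIncident (e : G.E) (v : G.V) : Prop :=
  ∃ (b : Bool) (d : G.Dir), Relation.ReflTransGen Continues (e, b) d ∧ term d = v

/-- A graph map: vertices go to vertices, and each edge is mapped across an edge path. -/
structure GraphMap (G : FinGraph) where
  onV : G.V → G.V
  onE : G.E → List G.Dir
  isPath_onE : ∀ e, IsPath (onV (G.src e)) (onV (G.tgt e)) (onE e)

namespace GraphMap

variable (f : GraphMap G)

/-- Image path of an oriented edge. -/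
def onDir (d : G.Dir) : List G.Dir :=
  if d.2 then f.onE d.1 else FreeGroup.invRev (f.onE d.1)

/-- Image of an edge path; no backtracking is removed. -/
def onPath (p : List G.Dir) : List G.Dir := p.flatMap f.onDir

/-- Train track map: every iterate is locally injective on the interior of every edge, that is,
no edge is collapsed and no iterated image of an edge backtracks. -/
def IsTrainTrack : Prop :=
  (∀ e, f.onE e ≠ []) ∧
    ∀ (k : ℕ) (e : G.E), 1 ≤ k → FreeGroup.IsReduced (f.onPath^[k] [(e, true)])

/-- Transition matrix: the entry `(i, j)` is the number of times that the image of the edge `i`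
crosses the edge `j`, in either direction. -/
def transitionMatrix : Matrix G.E G.E ℝ :=
  fun i j => (((f.onE i).map Prod.fst).count j : ℝ)

/-- The length function `ℓ` is a positive eigenvector of the transition matrix with an eigenvalue
`lam > 1`, scaled to volume one. -/
def IsExpandingEigenmetric (ℓ : G.E → ℝ) : Prop :=
  (∀ e, 0 < ℓ e) ∧ ∑ e, ℓ e = 1 ∧
    ∃ lam : ℝ, 1 < lam ∧ f.transitionMatrix.mulVec ℓ = lam • ℓ

/-- The map induced on directions: the first oriented edge of the image. (The default value of
`headD` is never used if no edge is collapsed.) -/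
def derivDir (d : G.Dir) : G.Dir := (f.onDir d).headD d

/-- The two directions `d`, `d'` form an illegal turn: they are distinct, they are based at the same
vertex, and some iterate of the map identifies them. -/
def IllegalTurn (d d' : G.Dir) : Prop :=
  init d = init d' ∧ d ≠ d' ∧ ∃ k : ℕ, 1 ≤ k ∧ f.derivDir^[k] d = f.derivDir^[k] d'

/-- The homomorphism of `FreeGroup G.E` that maps each edge to its image path; on classes of edge
paths it is the map induced by `f`. -/
def onFree : FreeGroup G.E →* FreeGroup G.E := FreeGroup.lift fun e => FreeGroup.mk (f.onE e)

end GraphMap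

end FinGraph

open FinGraph

/-! ### Marked graphs and outer space -/

/-- A marked graph: a connected finite graph without vertices of valence one, with an isomorphism
from the free group `F_N` to its fundamental group. Homotopy classes of edge paths in `G` are given
by their reduced representatives, hence by elements of `FreeGroup G.E`; the fundamental group at
`base` is the set of all elements of `FreeGroup G.E` that are represented by an edge loop at `base`.
So `marking` describes a homotopy equivalence from the rose `R_N` to `G`, taking the vertex of the
rose to `base`. -/
structure MarkedGraph (N : ℕ) extends FinGraph where
  connected : toFinGraph.IsConnected
  valence_ne_one : ∀ v : V, toFinGraph.valence v ≠ 1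
  base : V
  marking : FreeGroup (Fin N) →* FreeGroup E
  marking_injective : Function.Injective marking
  range_marking : Set.range marking =
    {g | ∃ p : List toFinGraph.Dir, IsPath base base p ∧ FreeGroup.mk p = g}

/-- Given edge lengths and a marking, the function that maps `x` to the length of the
shortest loop in the free homotopy class determined by `x`, which is the cyclically reduced one.
Equivalently: the translation length of `x` on the universal cover. -/
def lengthFunction {N : ℕ} {E : Type} [DecidableEq E] (m : FreeGroup (Fin N) →* FreeGroup E)
    (ℓ : E → ℝ) (x : FreeGroup (Fin N)) : ℝ :=
  ((FreeGroup.reduceCyclically (m x).toWord).map fun d => ℓ d.1).sum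

/-- Outer space: the space of marked metric graphs of volume one. Two of them are equivalent
(isometric by an isometry that commutes up to homotopy with the markings) if and only if they have
the same length function, so that a point of outer space is given by its length function. The
topology is the usual length function topology, that of pointwise convergence. -/
def OuterSpace (N : ℕ) : Type :=
  {L : FreeGroup (Fin N) → ℝ // ∃ (M : MarkedGraph N) (ℓ : M.E → ℝ),
    (∀ e, 0 < ℓ e) ∧ ∑ e, ℓ e = 1 ∧ L = lengthFunction M.marking ℓ}

instance (N : ℕ) : TopologicalSpace (OuterSpace N) := instTopologicalSpaceSubtype

/-- The point of outer space given by a marked graph and edge lengths of volume one. -/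
def MarkedGraph.point {N : ℕ} (M : MarkedGraph N) (ℓ : M.E → ℝ) (hpos : ∀ e, 0 < ℓ e)
    (hvol : ∑ e, ℓ e = 1) : OuterSpace N :=
  ⟨lengthFunction M.marking ℓ, M, ℓ, hpos, hvol, rfl⟩

/-! ### The axis bundle -/

/-- The graph map `f` of the marked graph `M` represents the automorphism `φ`: with `ι` the marking,
`f ∘ ι` is freely homotopic to `ι ∘ φ`, the base point running along the path `p`. This depends
only on the outer class of `φ`. -/
def Represents {N : ℕ} (M : MarkedGraph N) (f : GraphMap M.toFinGraph)
    (φ : MulAut (FreeGroup (Fin N))) : Prop :=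
  ∃ p : List M.toFinGraph.Dir, IsPath M.base (f.onV M.base) p ∧
    ∀ x, FreeGroup.mk p * f.onFree (M.marking x) * (FreeGroup.mk p)⁻¹ = M.marking (φ x)

/-- `TT(φ)`: the marked metric graphs on which there is a metric train track representative of `φ`,
that is, a train track map which represents `φ` and stretches every edge by the same factor
`lam > 1`. Vertices of valence two are allowed. -/
def TT {N : ℕ} (φ : MulAut (FreeGroup (Fin N))) : Set (OuterSpace N) :=
  {X | ∃ (M : MarkedGraph N) (ℓ : M.E → ℝ) (f : GraphMap M.toFinGraph),
    f.IsTrainTrack ∧ f.IsExpandingEigenmetric ℓ ∧ Represents M f φ ∧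
      X.1 = lengthFunction M.marking ℓ}

/-- The axis bundle: the closure in outer space of the union of `TT(φ ^ k)` over `k ≥ 1`. -/
def axisBundle {N : ℕ} (φ : MulAut (FreeGroup (Fin N))) : Set (OuterSpace N) :=
  closure (⋃ (k : ℕ) (_ : 1 ≤ k), TT (φ ^ k))

/-- `A` has local dimension at least `k` at `x`: every neighborhood of `x` contains a topologically
embedded copy of `ℝ^k` that lies in `A`. -/
def LocalDimAtLeast {X : Type} [TopologicalSpace X] (A : Set X) (x : X) (k : ℕ) : Prop :=
  ∀ U ∈ 𝓝 x, ∃ h : EuclideanSpace ℝ (Fin k) → X, IsEmbedding h ∧ Set.range h ⊆ U ∩ A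

/-! ### Simultaneous folds

Let `{a i, b i}`, for `i : Fin n`, be turns at distinct vertices. Identifying the initial segments
of length `t i` of `a i` and `b i`, for all `i` at once, gives a graph whose edges are the new
edges `c_i = Sum.inr i`, which are the images of the segments, and one edge `Sum.inl e` for each
old edge `e`, which is what remains of `e`. -/

/-- The quotient map from the old graph to the folded graph, on classes of edge paths: an edge `e`
goes to `c_i * e * c_j⁻¹`, where `c_i` is there only if `e` starts with a folded segment and `c_j`
only if its reverse does. -/
def foldHom {E : Type} [DecidableEq E] {n : ℕ} (a b : Fin n → E × Bool) :
    FreeGroup E →* FreeGroup (E ⊕ Fin n) :=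
  let start (d : E × Bool) : FreeGroup (E ⊕ Fin n) :=
    (List.ofFn fun i => if d = a i ∨ d = b i then FreeGroup.of (Sum.inr i) else 1).prod
  FreeGroup.lift fun e => start (e, true) * FreeGroup.of (Sum.inl e) * (start (e, false))⁻¹

/-- Edge lengths of the folded graph, rescaled to volume one: if the old volume is one, the fold
`i` takes `t i` off each of the two folded ends and adds an edge of length `t i`, so that the volume
before the rescaling is `1 - ∑ i, t i`. -/
noncomputable def foldLength {E : Type} [DecidableEq E] {n : ℕ} (a b : Fin n → E × Bool)
    (ℓ : E → ℝ) (t : Fin n → ℝ) : E ⊕ Fin n → ℝ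
  | Sum.inl e =>
      (ℓ e - ∑ i, ((if (a i).1 = e then t i else 0) + (if (b i).1 = e then t i else 0))) /
        (1 - ∑ i, t i)
  | Sum.inr i => t i / (1 - ∑ i, t i)

/-- `Y` is the point of outer space that is obtained from `M`, with edge lengths `ℓ`, by folding
simultaneously at each turn `{a i, b i}` by the length `t i` and rescaling to volume one. -/
def IsSimultaneousFold {N : ℕ} (M : MarkedGraph N) (ℓ : M.E → ℝ) {n : ℕ}
    (a b : Fin n → M.toFinGraph.Dir) (t : Fin n → ℝ) (Y : OuterSpace N) : Prop :=
  Y.1 = lengthFunction ((foldHom a b).comp M.marking) (foldLength a b ℓ t)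

end AxisBundle

/-! Two facts carry the theorem: small simultaneous folds stay in the axis bundle, and they are
determined by the resulting point of outer space.

Membership. Some power of `f` identifies the two directions of each illegal turn, so for large `k`
their `f^k`-images share prefixes of length at least `lam ^ k * η`
(`IllegalTurn.exists_common_prefix`). Suppose that the folded segments have lengths `s i` and that
`f^k` takes their endpoints to vertices inside these prefixes. Then `f^k` factors as `g ∘ fold`, and
`fold ∘ g` is a train track map on the folded graph representing `φ ^ k` with stretch factor `lam ^
k` (`mem_TT_of_prefixes`). Such `s` come within `lam ^ (-k)` of any small `t`, so by continuity
every small fold is a limit of train track points (`exists_fold_mem_axisBundle`).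

Injectivity. Folding shortens a loop by `2 * t i` at each crossing of turn `i`, and the result is
divided by `1 - ∑ t`. If `t` and `t'` give the same length function, then every loop `γ` satisfies
`κ * ℓ(γ) = 2 * ∑ r i * n i (γ)`, where `n i` counts the crossings, `κ = ∑ t - ∑ t'` and `r i = (1 -
∑ t') * t i - (1 - ∑ t) * t' i`. This is made local by weights `D` on half-edges
(`exists_halfEdge_weights`, `exists_balanced`): `D` vanishes at vertices of valence at least three
other than the `v i`, is `± 2 * r i` at `v i`, and sums to `2 * κ * ℓ` over each edge. A topological
edge that avoids all `v i` has `D = 0` at both ends, hence `κ = 0`. Then `|D|` is constant on the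
connected graph, so it vanishes everywhere and `t = t'`. Without such an edge, fixing `∑ t` gives `κ
= 0` and fixing one coordinate gives a zero of `D`, at the cost of two dimensions.

Finally, a continuous injection of a compact box into a Hausdorff space is an embedding. -/

namespace AxisBundle

/-! ### Weighted lengths of words and translation lengths -/

section Words

variable {E E' : Type}

/-- Total weight of a word. -/
def wordLength (w : E → ℝ) (p : List (E × Bool)) : ℝ := (p.map fun d => w d.1).sum

@[simp] theorem wordLength_nil (w : E → ℝ) : wordLength w [] = 0 := rfl

@[simp] theorem wordLength_cons (w : E → ℝ) (d : E × Bool) (p : List (E × Bool)) :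
    wordLength w (d :: p) = w d.1 + wordLength w p := by simp [wordLength]

@[simp] theorem wordLength_append (w : E → ℝ) (p q : List (E × Bool)) :
    wordLength w (p ++ q) = wordLength w p + wordLength w q := by simp [wordLength]

@[simp] theorem wordLength_invRev (w : E → ℝ) (p : List (E × Bool)) :
    wordLength w (FreeGroup.invRev p) = wordLength w p := by
  induction p with
  | nil => rfl
  | cons d p ih => rw [FreeGroup.invRev_cons, wordLength_append, ih]; simp [FreeGroup.invRev]; ring

theorem wordLength_flatten_replicate (w : E → ℝ) (p : List (E × Bool)) (k : ℕ) :
    wordLength w (List.replicate k p).flatten = k * wordLength w p := by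
  induction k with
  | zero => simp
  | succ k ih => rw [List.replicate_succ, List.flatten_cons, wordLength_append, ih]; push_cast; ring

theorem wordLength_nonneg {w : E → ℝ} (hw : ∀ e, 0 ≤ w e) (p : List (E × Bool)) :
    0 ≤ wordLength w p := by
  induction p with
  | nil => simp
  | cons d p ih => simpa using add_nonneg (hw _) ih

theorem wordLength_le_of_sublist {w : E → ℝ} (hw : ∀ e, 0 ≤ w e) {p q : List (E × Bool)}
    (h : p.Sublist q) : wordLength w p ≤ wordLength w q := by
  induction h with
  | slnil => simp
  | cons d _ ih => simpa using ih.trans (le_add_of_nonneg_left (hw _))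
  | cons_cons d _ ih => simpa using ih

theorem wordLength_flatMap (w : E → ℝ) (w' : E' → ℝ) (c : ℝ) (F : E × Bool → List (E' × Bool))
    (h : ∀ d, wordLength w' (F d) = c * w d.1) (p : List (E × Bool)) :
    wordLength w' (p.flatMap F) = c * wordLength w p := by
  induction p with
  | nil => simp
  | cons d p ih => simp [ih, h]; ring

theorem wordLength_lincomb (w w' : E → ℝ) (c c' : ℝ) (p : List (E × Bool)) :
    wordLength (fun e => c * w e - c' * w' e) p = c * wordLength w p - c' * wordLength w' p := by
  induction p with
  | nil => simp
  | cons d p ih => simp [ih]; ring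

variable [DecidableEq E] [DecidableEq E']

theorem wordLength_reduce_le {w : E → ℝ} (hw : ∀ e, 0 ≤ w e) (p : List (E × Bool)) :
    wordLength w (FreeGroup.reduce p) ≤ wordLength w p :=
  wordLength_le_of_sublist hw (FreeGroup.reduce.red (L := p)).sublist

/-- Weight of the cyclically reduced representative of the conjugacy class of `g`. -/
def translationLength (w : E → ℝ) (g : FreeGroup E) : ℝ :=
  wordLength w (FreeGroup.reduceCyclically g.toWord)

theorem lengthFunction_eq {N : ℕ} (m : FreeGroup (Fin N) →* FreeGroup E) (w : E → ℝ)
    (x : FreeGroup (Fin N)) : lengthFunction m w x = translationLength w (m x) := rfl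

/-- With `g = c r c⁻¹` and `r` cyclically reduced, the word `c r ⋯ r c⁻¹` is already reduced, so
only the copies of `r` grow with the exponent. -/
theorem wordLength_toWord_pow (w : E → ℝ) (g : FreeGroup E) (k : ℕ) :
    wordLength w (g ^ (k + 1)).toWord =
      2 * wordLength w (FreeGroup.reduceCyclically.conjugator g.toWord) +
        (k + 1) * translationLength w g := by
  rw [FreeGroup.toWord_pow, FreeGroup.reduceCyclically.reduce_flatten_replicate_succ
    FreeGroup.isReduced_toWord, wordLength_append, wordLength_append, wordLength_invRev,
    wordLength_flatten_replicate, translationLength]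
  push_cast; ring

/-- Translation lengths are determined by the lengths of powers, up to a bounded error. -/
theorem translationLength_eq_of_bounded {w : E → ℝ} {w' : E' → ℝ} {g : FreeGroup E}
    {g' : FreeGroup E'} {C : ℝ}
    (h : ∀ k : ℕ, |wordLength w (g ^ k).toWord - wordLength w' (g' ^ k).toWord| ≤ C) :
    translationLength w g = translationLength w' g' := by
  by_contra hne
  have hpos : 0 < |translationLength w g - translationLength w' g'| := abs_pos.2 (sub_ne_zero.2 hne)
  set A := 2 * wordLength w (FreeGroup.reduceCyclically.conjugator g.toWord)
  set B := 2 * wordLength w' (FreeGroup.reduceCyclically.conjugator g'.toWord)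
  obtain ⟨k, hk⟩ := exists_nat_gt ((C + |B - A|) / |translationLength w g - translationLength w' g'|)
  have h1 := h (k + 1)
  rw [wordLength_toWord_pow, wordLength_toWord_pow] at h1
  rw [div_lt_iff₀ hpos] at hk
  have h2 : ((k : ℝ) + 1) * |translationLength w g - translationLength w' g'| ≤ C + |B - A| := by
    rw [← abs_of_nonneg (by positivity : (0 : ℝ) ≤ k + 1), ← abs_mul]
    calc _ = |(A + (k + 1) * translationLength w g - (B + (k + 1) * translationLength w' g')) +
          (B - A)| := by congr 1; ring
      _ ≤ _ := (abs_add_le _ _).trans (by gcongr)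
  nlinarith

theorem abs_wordLength_reduce_cons_sub_le (w : E → ℝ) (d : E × Bool) (p : List (E × Bool)) :
    |wordLength w (FreeGroup.reduce (d :: p)) - wordLength w (FreeGroup.reduce p)| ≤ |w d.1| := by
  rw [FreeGroup.reduce.cons]
  rcases FreeGroup.reduce p with _ | ⟨e, q⟩
  · simp
  · by_cases h : d.1 = e.1 ∧ d.2 = !e.2
    · simp [h]
    · simp [h]

/-- Multiplying by one letter either adds or cancels one letter; induct on a word for `g`. -/
theorem exists_abs_wordLength_mul_sub_le (w : E → ℝ) (g : FreeGroup E) :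
    ∃ C, ∀ y, |wordLength w (g * y).toWord - wordLength w y.toWord| ≤ C := by
  obtain ⟨L, rfl⟩ : ∃ L, FreeGroup.mk L = g := ⟨g.toWord, FreeGroup.mk_toWord⟩
  induction L with
  | nil => exact ⟨0, fun y => by simp [← FreeGroup.one_eq_mk]⟩
  | cons d L ih =>
    obtain ⟨C, hC⟩ := ih
    refine ⟨|w d.1| + C, fun y => ?_⟩
    have e : ((FreeGroup.mk (d :: L)) * y).toWord =
        FreeGroup.reduce (d :: (FreeGroup.mk L * y).toWord) := by
      have h : ∀ q, FreeGroup.mk (d :: q) = FreeGroup.mk [d] * FreeGroup.mk q := fun q => rfl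
      rw [← FreeGroup.toWord_mk, h L, h (FreeGroup.toWord _), FreeGroup.mk_toWord, mul_assoc]
    have h1 := abs_wordLength_reduce_cons_sub_le w d (FreeGroup.mk L * y).toWord
    rw [← e, FreeGroup.reduce_toWord] at h1
    exact (abs_sub_le _ _ _).trans (add_le_add h1 (hC y))

theorem exists_abs_wordLength_conj_sub_le (w : E → ℝ) (g : FreeGroup E) :
    ∃ C, ∀ y, |wordLength w (g * y * g⁻¹).toWord - wordLength w y.toWord| ≤ C := by
  obtain ⟨C, hC⟩ := exists_abs_wordLength_mul_sub_le w g
  refine ⟨C + C, fun y => (abs_sub_le _ (wordLength w (y * g⁻¹).toWord) _).trans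
    (add_le_add ?_ ?_)⟩
  · rw [mul_assoc]; exact hC _
  · have := hC y⁻¹
    rw [show g * y⁻¹ = (y * g⁻¹)⁻¹ by group, FreeGroup.toWord_inv, FreeGroup.toWord_inv,
      wordLength_invRev, wordLength_invRev] at this
    exact this

/-- Conjugation changes the lengths of all powers by a bounded amount. The detour through powers,
instead of minimality in the conjugacy class, allows weights of either sign, which differences of
two metrics need. -/
theorem translationLength_conj (w : E → ℝ) (g y : FreeGroup E) :
    translationLength w (g * y * g⁻¹) = translationLength w y := by
  obtain ⟨C, hC⟩ := exists_abs_wordLength_conj_sub_le w g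
  refine translationLength_eq_of_bounded (C := C) fun k => ?_
  rw [conj_pow]
  exact hC _

theorem reduceCyclically_eq_self {p : List (E × Bool)} (h : FreeGroup.IsCyclicallyReduced p) :
    FreeGroup.reduceCyclically p = p := by
  induction p using List.bidirectionalRec with
  | nil => simp
  | singleton => simp
  | cons_append a l b ih =>
    rw [FreeGroup.reduceCyclically.cons_append, if_neg]
    · simp
    rintro ⟨h1, h2⟩
    have h3 := (FreeGroup.isCyclicallyReduced_cons_append_iff.1 h).2 h1
    rw [h3] at h2
    simp at h2

theorem translationLength_mk (w : E → ℝ) {p : List (E × Bool)}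
    (h : FreeGroup.IsCyclicallyReduced p) :
    translationLength w (FreeGroup.mk p) = wordLength w p := by
  rw [translationLength, FreeGroup.toWord_mk, h.isReduced.reduce_eq, reduceCyclically_eq_self h]

end Words

namespace FinGraph

/-! ### Edge paths and maps between graphs -/

section Paths

variable {G : FinGraph}

@[simp] theorem rev_rev (d : G.Dir) : rev (rev d) = d := by simp [rev]

@[simp] theorem init_rev (d : G.Dir) : init (rev d) = term d := rfl

@[simp] theorem term_rev (d : G.Dir) : term (rev d) = init d := by simp [term]

theorem isPath_append {u w : G.V} {p q : List G.Dir} :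
    IsPath u w (p ++ q) ↔ ∃ x, IsPath u x p ∧ IsPath x w q := by
  induction p generalizing u with
  | nil => simp [IsPath]
  | cons d p ih => simp [IsPath, ih, and_assoc]

theorem isPath_singleton (d : G.Dir) : IsPath (init d) (term d) [d] := ⟨rfl, rfl⟩

theorem IsPath.append {u x w : G.V} {p q : List G.Dir} (hp : IsPath u x p) (hq : IsPath x w q) :
    IsPath u w (p ++ q) := isPath_append.2 ⟨x, hp, hq⟩

theorem invRev_singleton (d : G.Dir) : FreeGroup.invRev [d] = [rev d] := rfl

theorem IsPath.invRev {u w : G.V} {p : List G.Dir} (h : IsPath u w p) :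
    IsPath w u (FreeGroup.invRev p) := by
  induction p generalizing u with
  | nil => exact Eq.symm h
  | cons d p ih =>
    rw [FreeGroup.invRev_cons]
    refine (ih h.2).append ?_
    have := isPath_singleton (rev d)
    rwa [term_rev, h.1] at this

/-- A map between graphs, described on oriented edges. -/
structure PathMap (G H : FinGraph) where
  onV : G.V → H.V
  onDir : G.Dir → List H.Dir
  isPath_onDir : ∀ d, IsPath (onV (init d)) (onV (term d)) (onDir d)
  onDir_rev : ∀ d, onDir (rev d) = FreeGroup.invRev (onDir d)

namespace PathMap

variable {H K : FinGraph} (φ : PathMap G H) (ψ : PathMap H K)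

def onPath (p : List G.Dir) : List H.Dir := p.flatMap φ.onDir

@[simp] theorem onPath_nil : φ.onPath [] = [] := rfl

@[simp] theorem onPath_cons (d : G.Dir) (p : List G.Dir) :
    φ.onPath (d :: p) = φ.onDir d ++ φ.onPath p := rfl

@[simp] theorem onPath_append (p q : List G.Dir) : φ.onPath (p ++ q) = φ.onPath p ++ φ.onPath q :=
  List.flatMap_append

theorem isPath_onPath {u w : G.V} {p : List G.Dir} (h : IsPath u w p) :
    IsPath (φ.onV u) (φ.onV w) (φ.onPath p) := by
  induction p generalizing u with
  | nil => exact congrArg φ.onV h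
  | cons d p ih =>
    have := φ.isPath_onDir d
    rw [h.1] at this
    exact this.append (ih h.2)

theorem onPath_invRev (p : List G.Dir) :
    φ.onPath (FreeGroup.invRev p) = FreeGroup.invRev (φ.onPath p) := by
  induction p with
  | nil => rfl
  | cons d p ih =>
    rw [FreeGroup.invRev_cons, onPath_append, ih, onPath_cons, FreeGroup.invRev_append,
      invRev_singleton, onPath_cons, φ.onDir_rev, onPath_nil, List.append_nil]

/-- A map that collapses no edge and maps a path to a reduced path is injective on the turns of
this path. -/
theorem isReduced_of_onPath (hφ : ∀ d, φ.onDir d ≠ []) {p : List G.Dir}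
    (h : FreeGroup.IsReduced (φ.onPath p)) : FreeGroup.IsReduced p := by
  rw [FreeGroup.isReduced_iff_not_step]
  rintro L ⟨⟩
  rename_i L₁ L₂ x b
  have hrev : φ.onDir (x, !b) = FreeGroup.invRev (φ.onDir (x, b)) := φ.onDir_rev (x, b)
  obtain ⟨A, d, hA⟩ : ∃ A d, φ.onDir (x, b) = A ++ [d] :=
    ⟨_, _, (List.dropLast_append_getLast (hφ _)).symm⟩
  rw [onPath_append, onPath_cons, onPath_cons, hrev, hA, FreeGroup.invRev_append,
    invRev_singleton] at h
  have h2 : FreeGroup.IsReduced [d, rev d] := h.infix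
    ⟨φ.onPath L₁ ++ A, FreeGroup.invRev A ++ φ.onPath L₂, by simp⟩
  have := (List.isChain_pair.1 h2) rfl
  simp [rev] at this

/-- The homomorphism induced on classes of edge paths. -/
def onFree : FreeGroup G.E →* FreeGroup H.E :=
  FreeGroup.lift fun e => FreeGroup.mk (φ.onDir (e, true))

theorem onFree_mk (p : List G.Dir) : φ.onFree (FreeGroup.mk p) = FreeGroup.mk (φ.onPath p) := by
  induction p with
  | nil => exact map_one _
  | cons d p ih =>
    rw [onPath_cons, ← FreeGroup.mul_mk, ← ih, ← List.singleton_append, ← FreeGroup.mul_mk, map_mul]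
    congr 1
    obtain ⟨e, _ | _⟩ := d
    · have h : φ.onDir (e, false) = FreeGroup.invRev (φ.onDir (e, true)) := φ.onDir_rev (e, true)
      rw [h, ← FreeGroup.inv_mk]
      change φ.onFree (FreeGroup.of e)⁻¹ = _
      rw [map_inv, onFree, FreeGroup.lift_apply_of]
    · change φ.onFree (FreeGroup.of e) = _
      rw [onFree, FreeGroup.lift_apply_of]

def comp : PathMap G K where
  onV := ψ.onV ∘ φ.onV
  onDir d := ψ.onPath (φ.onDir d)
  isPath_onDir d := ψ.isPath_onPath (φ.isPath_onDir d)
  onDir_rev d := by rw [φ.onDir_rev, onPath_invRev]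

theorem comp_onPath (p : List G.Dir) : (φ.comp ψ).onPath p = ψ.onPath (φ.onPath p) := by
  induction p with
  | nil => rfl
  | cons d p ih => rw [onPath_cons, ih, onPath_cons, onPath_append]; rfl

def toGraphMap (φ : PathMap G G) : GraphMap G where
  onV := φ.onV
  onE e := φ.onDir (e, true)
  isPath_onE e := φ.isPath_onDir (e, true)

theorem toGraphMap_onDir (φ : PathMap G G) (d : G.Dir) : φ.toGraphMap.onDir d = φ.onDir d := by
  obtain ⟨e, _ | _⟩ := d
  · exact (φ.onDir_rev (e, true)).symm
  · rfl

theorem toGraphMap_onPath (φ : PathMap G G) : φ.toGraphMap.onPath = φ.onPath := by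
  funext p
  exact congrArg (fun F => List.flatMap F p) (funext φ.toGraphMap_onDir)

protected def id (G : FinGraph) : PathMap G G where
  onV := id
  onDir d := [d]
  isPath_onDir := isPath_singleton
  onDir_rev _ := rfl

@[simp] theorem id_onPath (p : List G.Dir) : (PathMap.id G).onPath p = p :=
  List.flatMap_singleton' p

def iterate (φ : PathMap G G) : ℕ → PathMap G G
  | 0 => PathMap.id G
  | k + 1 => (iterate φ k).comp φ

theorem iterate_onPath (φ : PathMap G G) (k : ℕ) (p : List G.Dir) :
    (φ.iterate k).onPath p = φ.onPath^[k] p := by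
  induction k with
  | zero => exact id_onPath p
  | succ k ih => rw [iterate, comp_onPath, ih, Function.iterate_succ_apply']

theorem iterate_onDir (φ : PathMap G G) (k : ℕ) (d : G.Dir) :
    (φ.iterate k).onDir d = φ.onPath^[k] [d] := by
  rw [← iterate_onPath, onPath_cons, onPath_nil, List.append_nil]

end PathMap

namespace GraphMap

variable (f : GraphMap G)

def toPathMap : PathMap G G where
  onV := f.onV
  onDir := f.onDir
  isPath_onDir d := by
    obtain ⟨e, _ | _⟩ := d
    · exact (f.isPath_onE e).invRev
    · exact f.isPath_onE e
  onDir_rev d := by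
    obtain ⟨e, _ | _⟩ := d <;> simp [onDir, rev]

theorem toPathMap_onPath : f.toPathMap.onPath = f.onPath := rfl

theorem toPathMap_onFree : f.toPathMap.onFree = f.onFree := rfl

/-- The length of the image of an edge, in terms of the transition matrix. -/
theorem transitionMatrix_mulVec (ℓ : G.E → ℝ) (e : G.E) :
    f.transitionMatrix.mulVec ℓ e = wordLength ℓ (f.onE e) := by
  have key : ∀ p : List G.Dir, ∑ j, (((p.map Prod.fst).count j : ℕ) : ℝ) * ℓ j = wordLength ℓ p := by
    intro p
    induction p with
    | nil => simp
    | cons d p ih =>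
      simp only [List.map_cons, List.count_cons, wordLength_cons, Nat.cast_add, add_mul,
        Finset.sum_add_distrib, ih]
      rw [add_comm]
      congr 1
      simp
  exact key _

end GraphMap

end Paths

end FinGraph

open FinGraph

/-! ### Powers of a map -/

/-- Base point paths compose: if `p` serves `f^k` and `q` serves `f`, then `q` followed by `f(p)`
serves `f^(k+1)`. -/
theorem Represents.iterate {N : ℕ} {M : MarkedGraph N} {f : GraphMap M.toFinGraph}
    {φ : MulAut (FreeGroup (Fin N))} (h : Represents M f φ) (k : ℕ) :
    ∃ p : List M.toFinGraph.Dir, IsPath M.base ((f.toPathMap.iterate k).onV M.base) p ∧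
      ∀ x, FreeGroup.mk p * (f.toPathMap.iterate k).onFree (M.marking x) * (FreeGroup.mk p)⁻¹ =
        M.marking ((φ ^ k) x) := by
  have hcomp : ∀ (φ ψ : PathMap M.toFinGraph M.toFinGraph) g,
      (φ.comp ψ).onFree g = ψ.onFree (φ.onFree g) := by
    intro φ ψ g
    obtain ⟨p, rfl⟩ : ∃ p, FreeGroup.mk p = g := ⟨g.toWord, FreeGroup.mk_toWord⟩
    rw [PathMap.onFree_mk, PathMap.onFree_mk, PathMap.onFree_mk, PathMap.comp_onPath]
  induction k with
  | zero =>
    refine ⟨[], rfl, fun x => ?_⟩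
    obtain ⟨p, hp⟩ : ∃ p, FreeGroup.mk p = M.marking x :=
      ⟨(M.marking x).toWord, FreeGroup.mk_toWord⟩
    rw [← FreeGroup.one_eq_mk, ← hp, PathMap.onFree_mk, PathMap.iterate, PathMap.id_onPath]
    simpa using hp
  | succ k ih =>
    obtain ⟨p, hp, hpx⟩ := ih
    obtain ⟨q, hq, hqx⟩ := h
    refine ⟨q ++ f.toPathMap.onPath p, hq.append (f.toPathMap.isPath_onPath hp), fun x => ?_⟩
    rw [PathMap.iterate, hcomp, pow_succ', MulAut.mul_apply, ← hqx, ← hpx, map_mul, map_mul, map_inv,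
      ← GraphMap.toPathMap_onFree, PathMap.onFree_mk, ← FreeGroup.mul_mk]
    group

namespace FinGraph

/-! ### Folding turns at vertices of valence three -/

section Fold

variable {G : FinGraph}

theorem valence_eq_card (v : G.V) :
    valence v = (Finset.univ.filter fun d : G.Dir => init d = v).card :=
  Fintype.card_subtype _

theorem valence_ne_one_iff {v : G.V} :
    valence v ≠ 1 ↔ ∀ d : G.Dir, init d = v → ∃ d' : G.Dir, init d' = v ∧ d' ≠ d := by
  rw [valence_eq_card, Ne, Finset.card_eq_one]
  constructor
  · intro h d hd
    by_contra! h'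
    refine h ⟨d, ?_⟩
    ext x
    simp only [Finset.mem_filter, Finset.mem_univ, true_and, Finset.mem_singleton]
    exact ⟨fun hx => h' x hx, fun hx => hx ▸ hd⟩
  · rintro h ⟨d, hd⟩
    have hmem : ∀ x : G.Dir, init x = v ↔ x = d := fun x => by
      simpa using Finset.ext_iff.1 hd x
    obtain ⟨d', h1, h2⟩ := h d ((hmem d).2 rfl)
    exact h2 ((hmem d').1 h1)

theorem exists_third_direction {v : G.V} (hv : valence v = 3) {a b : G.Dir} (ha : init a = v)
    (hb : init b = v) (hab : a ≠ b) : ∃ c : G.Dir, init c = v ∧ c ≠ a ∧ c ≠ b ∧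
      ∀ x, init x = v → x = a ∨ x = b ∨ x = c := by
  rw [valence_eq_card] at hv
  set S := Finset.univ.filter fun d : G.Dir => init d = v with hS
  have h1 : ((S.erase a).erase b).card = 1 := by
    rw [Finset.card_erase_of_mem, Finset.card_erase_of_mem, hv] <;> simp [hS, ha, hb, hab.symm]
  obtain ⟨c, hc⟩ := Finset.card_eq_one.1 h1
  have hmem : ∀ x, (x ≠ b ∧ x ≠ a ∧ init x = v) ↔ x = c := fun x => by
    simpa [hS] using Finset.ext_iff.1 hc x
  obtain ⟨h2, h3, h4⟩ := (hmem c).2 rfl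
  refine ⟨c, h4, h3, h2, fun x hx => ?_⟩
  by_contra! h
  exact h.2.2 ((hmem x).1 ⟨h.2.1, h.1, hx⟩)

/-- Turns at distinct vertices of valence three. -/
structure TurnFamily (G : FinGraph) (n : ℕ) where
  a : Fin n → G.Dir
  b : Fin n → G.Dir
  init_b : ∀ i, init (b i) = init (a i)
  ne : ∀ i, a i ≠ b i
  init_injective : Function.Injective fun i => init (a i)
  valence_eq : ∀ i, valence (init (a i)) = 3

namespace TurnFamily

variable {n : ℕ} (T : TurnFamily G n)

open Classical in
/-- The turn to which a direction belongs. -/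
noncomputable def index (d : G.Dir) : Option (Fin n) :=
  if h : ∃ i, d = T.a i ∨ d = T.b i then some h.choose else none

variable {T} in
theorem init_of_mem {d : G.Dir} {i : Fin n} (h : d = T.a i ∨ d = T.b i) :
    init d = init (T.a i) := by
  rcases h with rfl | rfl
  · rfl
  · exact T.init_b i

theorem index_eq_some {d : G.Dir} {i : Fin n} : T.index d = some i ↔ d = T.a i ∨ d = T.b i := by
  rw [index]
  constructor
  · intro h
    split at h
    · rename_i h'
      cases h
      exact h'.choose_spec
    · cases h
  · intro h
    have h' : ∃ i, d = T.a i ∨ d = T.b i := ⟨i, h⟩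
    rw [dif_pos h']
    congr 1
    exact T.init_injective ((init_of_mem h'.choose_spec).symm.trans (init_of_mem h))

theorem index_a (i : Fin n) : T.index (T.a i) = some i := T.index_eq_some.2 (Or.inl rfl)

theorem index_b (i : Fin n) : T.index (T.b i) = some i := T.index_eq_some.2 (Or.inr rfl)

theorem init_eq_of_index {d : G.Dir} {i : Fin n} (h : T.index d = some i) :
    init d = init (T.a i) := init_of_mem (T.index_eq_some.1 h)

/-- The initial vertex of what remains of an edge in the folded graph. -/
noncomputable def foldInit (d : G.Dir) : G.V ⊕ Fin n :=
  match T.index d with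
  | some i => Sum.inr i
  | none => Sum.inl (init d)

theorem foldInit_of_some {d : G.Dir} {i : Fin n} (h : T.index d = some i) :
    T.foldInit d = Sum.inr i := by rw [foldInit, h]

theorem foldInit_of_none {d : G.Dir} (h : T.index d = none) :
    T.foldInit d = Sum.inl (init d) := by rw [foldInit, h]

/-- The graph obtained by folding all turns of the family at once. -/
noncomputable abbrev foldGraph : FinGraph where
  V := G.V ⊕ Fin n
  E := G.E ⊕ Fin n
  src := Sum.elim (fun e => T.foldInit (e, true)) fun i => Sum.inl (init (T.a i))
  tgt := Sum.elim (fun e => T.foldInit (e, false)) fun i => Sum.inr i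

/-- What remains of an oriented edge in the folded graph. -/
def old (d : G.Dir) : T.foldGraph.Dir := (Sum.inl d.1, d.2)

/-- The new edge, from the old vertex to the new one. -/
def new (i : Fin n) : T.foldGraph.Dir := (Sum.inr i, true)

@[simp] theorem init_old (d : G.Dir) : init (T.old d) = T.foldInit d := by
  obtain ⟨e, _ | _⟩ := d <;> rfl

@[simp] theorem rev_old (d : G.Dir) : rev (T.old d) = T.old (rev d) := rfl

@[simp] theorem term_old (d : G.Dir) : term (T.old d) = T.foldInit (rev d) := T.init_old (rev d)

@[simp] theorem init_new (i : Fin n) : init (T.new i) = Sum.inl (init (T.a i)) := rfl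

@[simp] theorem term_new (i : Fin n) : term (T.new i) = Sum.inr i := rfl

theorem old_injective : Function.Injective T.old := by
  rintro ⟨e, b⟩ ⟨e', b'⟩ h
  simpa [old] using h

theorem old_ne_new (d : G.Dir) (i : Fin n) : T.old d ≠ T.new i := by simp [old, new]

theorem old_ne_rev_new (d : G.Dir) (i : Fin n) : T.old d ≠ rev (T.new i) := by simp [old, new, rev]

theorem dir_cases (x : T.foldGraph.Dir) :
    (∃ d, x = T.old d) ∨ (∃ i, x = T.new i) ∨ ∃ i, x = rev (T.new i) := by
  obtain ⟨e | i, _ | _⟩ := x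
  · exact Or.inl ⟨(e, false), rfl⟩
  · exact Or.inl ⟨(e, true), rfl⟩
  · exact Or.inr (Or.inr ⟨i, rfl⟩)
  · exact Or.inr (Or.inl ⟨i, rfl⟩)

/-- The folded segment at the beginning of an oriented edge. -/
noncomputable def start (d : G.Dir) : List T.foldGraph.Dir :=
  match T.index d with
  | some i => [T.new i]
  | none => []

theorem start_of_some {d : G.Dir} {i : Fin n} (h : T.index d = some i) :
    T.start d = [T.new i] := by rw [start, h]

theorem start_of_none {d : G.Dir} (h : T.index d = none) : T.start d = [] := by rw [start, h]

theorem isPath_start (d : G.Dir) : IsPath (Sum.inl (init d)) (T.foldInit d) (T.start d) := by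
  cases h : T.index d with
  | none => rw [T.start_of_none h, T.foldInit_of_none h]; rfl
  | some i =>
    rw [T.start_of_some h, T.foldInit_of_some h, T.init_eq_of_index h]
    exact isPath_singleton (T.new i)

/-- The folding map. -/
noncomputable def fold : PathMap G T.foldGraph where
  onV := Sum.inl
  onDir d := T.start d ++ T.old d :: FreeGroup.invRev (T.start (rev d))
  isPath_onDir d := (T.isPath_start d).append
    ⟨T.init_old d, by rw [term_old]; exact (T.isPath_start (rev d)).invRev⟩
  onDir_rev d := by
    rw [FreeGroup.invRev_append, FreeGroup.invRev_cons, FreeGroup.invRev_invRev, invRev_singleton,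
      rev_rev, rev_old]
    simp

theorem fold_onDir (d : G.Dir) :
    T.fold.onDir d = T.start d ++ T.old d :: FreeGroup.invRev (T.start (rev d)) := rfl

/-- The homotopy inverse of the folding map, collapsing the new edges. -/
def collapse : PathMap T.foldGraph G where
  onV := Sum.elim id fun i => init (T.a i)
  onDir x := Sum.elim (fun e => [(e, x.2)]) (fun _ => []) x.1
  isPath_onDir x := by
    have h : ∀ d : G.Dir, Sum.elim id (fun i => init (T.a i)) (T.foldInit d) = init d := by
      intro d
      cases h : T.index d with
      | none => rw [T.foldInit_of_none h]; rfl
      | some i => rw [T.foldInit_of_some h, T.init_eq_of_index h]; rfl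
    obtain ⟨d, rfl⟩ | ⟨i, rfl⟩ | ⟨i, rfl⟩ := T.dir_cases x
    · rw [init_old, term_old, h, h]
      exact isPath_singleton d
    · rfl
    · rfl
  onDir_rev x := by
    obtain ⟨e | i, _ | _⟩ := x <;> rfl

theorem collapse_onPath_start (d : G.Dir) : T.collapse.onPath (T.start d) = [] := by
  cases h : T.index d with
  | none => rw [T.start_of_none h]; rfl
  | some i => rw [T.start_of_some h]; rfl

theorem collapse_onPath_fold_onDir (d : G.Dir) : T.collapse.onPath (T.fold.onDir d) = [d] := by
  rw [fold_onDir, PathMap.onPath_append, PathMap.onPath_cons, PathMap.onPath_invRev,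
    collapse_onPath_start, collapse_onPath_start]
  rfl

theorem collapse_onPath_fold (p : List G.Dir) : T.collapse.onPath (T.fold.onPath p) = p := by
  induction p with
  | nil => rfl
  | cons d p ih =>
    rw [PathMap.onPath_cons, PathMap.onPath_append, ih, collapse_onPath_fold_onDir]; rfl

theorem collapse_onFree_fold (g : FreeGroup G.E) :
    T.collapse.onFree (T.fold.onFree g) = g := by
  obtain ⟨p, rfl⟩ : ∃ p, FreeGroup.mk p = g := ⟨g.toWord, FreeGroup.mk_toWord⟩
  rw [PathMap.onFree_mk, PathMap.onFree_mk, collapse_onPath_fold]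

/-- The path from an old vertex to the vertex of the folded graph which collapses to it. -/
def tail (u : T.foldGraph.V) : FreeGroup T.foldGraph.E :=
  Sum.elim (fun _ => 1) (fun i => FreeGroup.of (Sum.inr i)) u

theorem mk_start (d : G.Dir) : FreeGroup.mk (T.start d) = T.tail (T.foldInit d) := by
  cases h : T.index d with
  | none => rw [T.start_of_none h, T.foldInit_of_none h]; rfl
  | some i => rw [T.start_of_some h, T.foldInit_of_some h]; rfl

/-- `fold ∘ collapse` is homotopic to the identity, each vertex moving along its `tail`. At old
vertices, in particular at the base point, the tail is trivial, which gives the range of the folded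
marking. -/
theorem fold_onFree_collapse_dir (x : T.foldGraph.Dir) :
    FreeGroup.mk (T.fold.onPath (T.collapse.onDir x)) =
      T.tail (init x) * FreeGroup.mk [x] * (T.tail (term x))⁻¹ := by
  obtain ⟨d, rfl⟩ | ⟨i, rfl⟩ | ⟨i, rfl⟩ := T.dir_cases x
  · rw [init_old, term_old, ← mk_start, ← mk_start]
    change FreeGroup.mk (T.fold.onPath [d]) = _
    rw [PathMap.onPath_cons, PathMap.onPath_nil, List.append_nil, fold_onDir, FreeGroup.inv_mk,
      FreeGroup.mul_mk, FreeGroup.mul_mk]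
    simp
  · have h : FreeGroup.mk [T.new i] = FreeGroup.of (Sum.inr i) := rfl
    rw [init_new, term_new, h]
    change 1 = 1 * _ * _
    simp [tail]
  · have h : FreeGroup.mk [rev (T.new i)] = (FreeGroup.of (Sum.inr i))⁻¹ := rfl
    rw [init_rev, term_rev, init_new, term_new, h]
    change 1 = FreeGroup.of (Sum.inr i) * (FreeGroup.of (Sum.inr i))⁻¹ * 1⁻¹
    simp

theorem fold_onFree_collapse {u w : T.foldGraph.V} {p : List T.foldGraph.Dir} (h : IsPath u w p) :
    FreeGroup.mk (T.fold.onPath (T.collapse.onPath p)) =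
      T.tail u * FreeGroup.mk p * (T.tail w)⁻¹ := by
  induction p generalizing u with
  | nil => cases h; simp [← FreeGroup.one_eq_mk]
  | cons x p ih =>
    obtain ⟨rfl, h⟩ := h
    have hx : FreeGroup.mk (x :: p) = FreeGroup.mk [x] * FreeGroup.mk p := rfl
    rw [PathMap.onPath_cons, PathMap.onPath_append, ← FreeGroup.mul_mk, ih h,
      fold_onFree_collapse_dir, hx]
    group

theorem list_ofFn_prod_single {A : Type*} [Monoid A] {m : ℕ} (i : Fin m) (F : Fin m → A)
    (h : ∀ j, j ≠ i → F j = 1) : (List.ofFn F).prod = F i := by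
  induction m with
  | zero => exact i.elim0
  | succ m ih =>
    rw [List.ofFn_succ, List.prod_cons]
    induction i using Fin.cases with
    | zero =>
      rw [show (fun j : Fin m => F j.succ) = fun _ => 1 from
        funext fun j => h _ (Fin.succ_ne_zero j)]
      simp
    | succ i =>
      rw [h 0 (Fin.succ_ne_zero i).symm, one_mul]
      exact ih i (fun j => F j.succ) fun j hj => h _ fun e => hj (Fin.succ_injective _ e)

/-- The turns sit at distinct vertices, so a direction belongs to at most one of them and each
product has at most one nontrivial factor. -/
theorem foldHom_eq : foldHom T.a T.b = T.fold.onFree := by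
  have hs : ∀ d : G.Dir, (List.ofFn fun i => if d = T.a i ∨ d = T.b i then
      FreeGroup.of (Sum.inr i : G.E ⊕ Fin n) else 1).prod = FreeGroup.mk (T.start d) := by
    intro d
    cases h : T.index d with
    | none =>
      rw [T.start_of_none h]
      have : ∀ i, ¬ (d = T.a i ∨ d = T.b i) := fun i hi => by
        rw [T.index_eq_some.2 hi] at h; cases h
      simp [this, ← FreeGroup.one_eq_mk]
    | some i =>
      rw [T.start_of_some h, list_ofFn_prod_single i]
      · rw [if_pos (T.index_eq_some.1 h)]; rfl
      · intro j hj
        refine if_neg fun h' => hj ?_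
        rw [T.index_eq_some.2 h'] at h
        exact Option.some_injective _ h
  refine FreeGroup.ext_hom _ _ fun e => ?_
  rw [foldHom, PathMap.onFree, FreeGroup.lift_apply_of, FreeGroup.lift_apply_of]
  beta_reduce
  rw [hs, hs, fold_onDir, FreeGroup.inv_mk]
  change FreeGroup.mk _ * FreeGroup.mk [T.old (e, true)] * _ = _
  rw [FreeGroup.mul_mk, FreeGroup.mul_mk]
  simp [rev]

theorem foldGraph_connected (h : G.IsConnected) : T.foldGraph.IsConnected := by
  obtain ⟨⟨v₀⟩, hG⟩ := h
  refine ⟨⟨Sum.inl v₀⟩, ?_⟩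
  have key : ∀ u : T.foldGraph.V, ∃ p, IsPath (Sum.inl v₀) u p := by
    have h1 : ∀ v : G.V, ∃ p, IsPath (G := T.foldGraph) (Sum.inl v₀) (Sum.inl v) p := fun v => by
      obtain ⟨p, hp⟩ := hG v₀ v
      exact ⟨_, T.fold.isPath_onPath hp⟩
    rintro (v | i)
    · exact h1 v
    · obtain ⟨p, hp⟩ := h1 (init (T.a i))
      exact ⟨_, hp.append (isPath_singleton (T.new i))⟩
  intro u w
  obtain ⟨p, hp⟩ := key u
  obtain ⟨q, hq⟩ := key w
  exact ⟨_, hp.invRev.append hq⟩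

/-- At the old vertex of a turn the third direction survives beside the new edge, leaving valence
two; at the new vertex both folded edges and the new edge meet. -/
theorem foldGraph_valence_ne_one (h : ∀ v : G.V, valence v ≠ 1) (u : T.foldGraph.V) :
    valence u ≠ 1 := by
  rw [valence_ne_one_iff]
  intro x hx
  rcases u with v | i
  · by_cases hv : ∃ i, init (T.a i) = v
    · obtain ⟨i, rfl⟩ := hv
      by_cases hxi : x = T.new i
      · obtain ⟨c, hc, hca, hcb, -⟩ := exists_third_direction (T.valence_eq i) rfl (T.init_b i) (T.ne i)
        have hn : T.index c = none := by
          rw [Option.eq_none_iff_forall_ne_some]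
          intro j hj
          obtain rfl : i = j := T.init_injective (hc.symm.trans (T.init_eq_of_index hj))
          exact (T.index_eq_some.1 hj).elim hca hcb
        refine ⟨T.old c, by rw [init_old, T.foldInit_of_none hn, hc], ?_⟩
        rw [hxi]
        exact T.old_ne_new c i
      · exact ⟨T.new i, T.init_new i, Ne.symm hxi⟩
    · have hnone : ∀ d : G.Dir, init d = v → T.index d = none := fun d hd => by
        rw [Option.eq_none_iff_forall_ne_some]
        exact fun j hj => hv ⟨j, (T.init_eq_of_index hj).symm.trans hd⟩
      obtain ⟨d, rfl⟩ | ⟨i, rfl⟩ | ⟨i, rfl⟩ := T.dir_cases x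
      · have hd : init d = v := by
          rw [init_old] at hx
          cases h' : T.index d with
          | none => rw [T.foldInit_of_none h'] at hx; exact Sum.inl_injective hx
          | some i => rw [T.foldInit_of_some h'] at hx; cases hx
        obtain ⟨d', h1, h2⟩ := valence_ne_one_iff.1 (h v) d hd
        exact ⟨T.old d', by rw [init_old, T.foldInit_of_none (hnone d' h1), h1],
          fun e => h2 (T.old_injective e)⟩
      · exact absurd ⟨i, Sum.inl_injective hx⟩ hv
      · rw [init_rev, term_new] at hx; cases hx
  · have ha : init (T.old (T.a i)) = Sum.inr i := by rw [init_old, T.foldInit_of_some (T.index_a i)]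
    have hb : init (T.old (T.b i)) = Sum.inr i := by rw [init_old, T.foldInit_of_some (T.index_b i)]
    by_cases hxa : x = T.old (T.a i)
    · exact ⟨T.old (T.b i), hb, fun e => T.ne i (T.old_injective (hxa.symm.trans e.symm))⟩
    · exact ⟨T.old (T.a i), ha, Ne.symm hxa⟩

end TurnFamily

end Fold

end FinGraph

/-- The folded graph as a marked graph. -/
noncomputable def MarkedGraph.fold {N n : ℕ} (M : MarkedGraph N)
    (T : TurnFamily M.toFinGraph n) : MarkedGraph N where
  toFinGraph := T.foldGraph
  connected := T.foldGraph_connected M.connected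
  valence_ne_one := T.foldGraph_valence_ne_one M.valence_ne_one
  base := Sum.inl M.base
  marking := (foldHom T.a T.b).comp M.marking
  marking_injective := by
    rw [T.foldHom_eq, MonoidHom.coe_comp]
    exact (Function.LeftInverse.injective T.collapse_onFree_fold).comp M.marking_injective
  range_marking := by
    ext g
    rw [T.foldHom_eq]
    constructor
    · rintro ⟨x, rfl⟩
      have hx : M.marking x ∈ Set.range M.marking := ⟨x, rfl⟩
      rw [M.range_marking] at hx
      obtain ⟨p, hp, hpx⟩ := hx
      exact ⟨_, T.fold.isPath_onPath hp, by rw [← PathMap.onFree_mk, hpx]; rfl⟩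
    · rintro ⟨p, hp, rfl⟩
      have hx : FreeGroup.mk (T.collapse.onPath p) ∈ Set.range M.marking := by
        rw [M.range_marking]
        exact ⟨_, T.collapse.isPath_onPath hp, rfl⟩
      obtain ⟨x, hx⟩ := hx
      refine ⟨x, ?_⟩
      rw [MonoidHom.comp_apply, hx, PathMap.onFree_mk, T.fold_onFree_collapse hp]
      change 1 * _ * 1⁻¹ = _
      simp

namespace FinGraph

/-! ### Train track maps on folded graphs -/

section FoldedTrainTrack

variable {G H : FinGraph}

/-- The last vertex of an edge path. -/
def pathEnd (u : G.V) : List G.Dir → G.V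
  | [] => u
  | d :: p => pathEnd (term d) p

theorem isPath_append_iff_pathEnd {u w : G.V} {p q : List G.Dir} (h : IsPath u w (p ++ q)) :
    IsPath u (pathEnd u p) p ∧ IsPath (pathEnd u p) w q := by
  induction p generalizing u with
  | nil => exact ⟨rfl, h⟩
  | cons d p ih => exact ⟨⟨h.1, (ih h.2).1⟩, (ih h.2).2⟩

/-- A map between graphs, described on positively oriented edges. -/
def PathMap.ofEdges (onV : G.V → H.V) (onE : G.E → List H.Dir)
    (h : ∀ e, IsPath (onV (G.src e)) (onV (G.tgt e)) (onE e)) : PathMap G H where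
  onV := onV
  onDir d := if d.2 then onE d.1 else FreeGroup.invRev (onE d.1)
  isPath_onDir d := by
    obtain ⟨e, _ | _⟩ := d
    · exact (h e).invRev
    · exact h e
  onDir_rev d := by
    obtain ⟨e, _ | _⟩ := d <;> simp [rev]

theorem PathMap.onPath_infix (φ : PathMap G H) {p q : List G.Dir} (h : p <:+: q) :
    φ.onPath p <:+: φ.onPath q := by
  obtain ⟨s, t, rfl⟩ := h
  exact ⟨φ.onPath s, φ.onPath t, by simp⟩

theorem PathMap.onPath_iterate_infix (φ : PathMap G G) {p q : List G.Dir} (h : p <:+: q) (m : ℕ) :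
    φ.onPath^[m] p <:+: φ.onPath^[m] q := by
  rw [← iterate_onPath, ← iterate_onPath]
  exact onPath_infix _ h

/-- A prefix and a suffix whose lengths add up to less than the whole cannot overlap or touch. -/
theorem exists_middle {E : Type} {ℓ : E → ℝ} (hℓ : ∀ e, 0 < ℓ e) {X A B : List (E × Bool)}
    (hA : A <+: X) (hB : B <:+ X) (h : wordLength ℓ A + wordLength ℓ B < wordLength ℓ X) :
    ∃ m, m ≠ [] ∧ X = A ++ m ++ B := by
  obtain ⟨X₁, rfl⟩ := hA
  obtain ⟨Y₁, hY⟩ := hB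
  rcases List.append_eq_append_iff.1 hY.symm with ⟨m, rfl, rfl⟩ | ⟨c, rfl, rfl⟩
  · refine ⟨m, ?_, by simp⟩
    rintro rfl
    simp at h
  · have := wordLength_nonneg (fun e => (hℓ e).le) c
    simp only [wordLength_append] at h
    linarith

namespace TurnFamily

variable {n : ℕ} (T : TurnFamily G n)

/-- The length by which the beginning of an oriented edge is folded. -/
noncomputable def amount (t : Fin n → ℝ) (d : G.Dir) : ℝ :=
  match T.index d with
  | some i => t i
  | none => 0

theorem amount_of_some {t : Fin n → ℝ} {d : G.Dir} {i : Fin n} (h : T.index d = some i) :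
    T.amount t d = t i := by rw [amount, h]

theorem amount_of_none {t : Fin n → ℝ} {d : G.Dir} (h : T.index d = none) :
    T.amount t d = 0 := by rw [amount, h]

theorem amount_eq_sum (t : Fin n → ℝ) (d : G.Dir) :
    T.amount t d = ∑ i, if d = T.a i ∨ d = T.b i then t i else 0 := by
  simp_rw [← T.index_eq_some]
  cases h : T.index d with
  | none => simp [T.amount_of_none h]
  | some i => simp [T.amount_of_some h]

/-- The two directions of a turn may be the two ends of one loop. As they are distinct, each
contributes to a different end of the edge. -/
theorem sum_eq_amount (t : Fin n → ℝ) (e : G.E) :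
    ∑ i, ((if (T.a i).1 = e then t i else 0) + (if (T.b i).1 = e then t i else 0)) =
      T.amount t (e, true) + T.amount t (e, false) := by
  rw [amount_eq_sum, amount_eq_sum, ← Finset.sum_add_distrib]
  refine Finset.sum_congr rfl fun i _ => ?_
  have hne := T.ne i
  generalize T.a i = p, T.b i = q at hne ⊢
  obtain ⟨x, s⟩ := p
  obtain ⟨y, s'⟩ := q
  by_cases hx : x = e <;> by_cases hy : y = e <;> cases s <;> cases s' <;>
    simp_all [Prod.ext_iff, eq_comm]

theorem foldLength_inl (ℓ : G.E → ℝ) (t : Fin n → ℝ) (e : G.E) :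
    foldLength T.a T.b ℓ t (Sum.inl e) =
      (ℓ e - T.amount t (e, true) - T.amount t (e, false)) / (1 - ∑ i, t i) := by
  rw [foldLength, sum_eq_amount, sub_sub]

theorem foldLength_old (ℓ : G.E → ℝ) (t : Fin n → ℝ) (d : G.Dir) :
    foldLength T.a T.b ℓ t (T.old d).1 =
      (ℓ d.1 - T.amount t d - T.amount t (rev d)) / (1 - ∑ i, t i) := by
  obtain ⟨e, _ | _⟩ := d
  · change foldLength T.a T.b ℓ t (Sum.inl e) = _
    rw [foldLength_inl]
    change _ = (ℓ e - _ - T.amount t (e, true)) / _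
    ring
  · exact T.foldLength_inl ℓ t e

theorem amount_lt {t : Fin n → ℝ} {δ : ℝ} (hδ : 0 < δ) (ht : ∀ i, t i < δ) (d : G.Dir) :
    T.amount t d < δ := by
  cases h : T.index d with
  | none => rwa [T.amount_of_none h]
  | some i => rw [T.amount_of_some h]; exact ht i

/-- Both ends of an edge may be folded, each by less than `δ`; hence the bound `2 * δ`. -/
theorem foldLength_pos {ℓ : G.E → ℝ} {t : Fin n → ℝ} {δ : ℝ} (hδ : 0 < δ) (hℓ : ∀ e, 2 * δ ≤ ℓ e)
    (ht : ∀ i, 0 < t i ∧ t i < δ) (hsum : ∑ i, t i < 1) (x : G.E ⊕ Fin n) :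
    0 < foldLength T.a T.b ℓ t x := by
  rcases x with e | i
  · rw [foldLength_inl]
    refine div_pos ?_ (by linarith)
    have h1 := T.amount_lt hδ (fun i => (ht i).2) (e, true)
    have h2 := T.amount_lt hδ (fun i => (ht i).2) (e, false)
    linarith [hℓ e]
  · exact div_pos (ht i).1 (by linarith)

theorem sum_foldLength {ℓ : G.E → ℝ} (hℓ : ∑ e, ℓ e = 1) {t : Fin n → ℝ} (hsum : ∑ i, t i < 1) :
    ∑ x, foldLength T.a T.b ℓ t x = 1 := by
  have h : ∑ e, ∑ i, ((if (T.a i).1 = e then t i else 0) + (if (T.b i).1 = e then t i else 0)) =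
      2 * ∑ i, t i := by
    rw [Finset.sum_comm, Finset.mul_sum]
    refine Finset.sum_congr rfl fun i _ => ?_
    rw [Finset.sum_add_distrib]
    simp; ring
  rw [Fintype.sum_sum_type]
  simp only [foldLength]
  rw [← Finset.sum_div, ← Finset.sum_div, Finset.sum_sub_distrib, h, hℓ, ← add_div,
    div_eq_one_iff_eq (by linarith)]
  ring

theorem wordLength_start (ℓ : G.E → ℝ) (t : Fin n → ℝ) (d : G.Dir) :
    wordLength (foldLength T.a T.b ℓ t) (T.start d) = T.amount t d / (1 - ∑ i, t i) := by
  cases h : T.index d with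
  | none => simp [T.start_of_none h, T.amount_of_none h]
  | some i => simp [T.start_of_some h, T.amount_of_some h, new, foldLength]

/-- Up to the rescaling, folding is an isometry on each edge: what the remaining piece loses, the
new edges at its ends give back. -/
theorem wordLength_fold_onDir (ℓ : G.E → ℝ) (t : Fin n → ℝ) (d : G.Dir) :
    wordLength (foldLength T.a T.b ℓ t) (T.fold.onDir d) = (1 - ∑ i, t i)⁻¹ * ℓ d.1 := by
  rw [fold_onDir, wordLength_append, wordLength_cons, wordLength_invRev, wordLength_start,
    wordLength_start, foldLength_old]
  ring

/-! #### Factoring a map through the fold -/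

/-- The prefix of the image of an oriented edge that is the image of its folded segment. -/
noncomputable def pre (P : Fin n → List H.Dir) (d : G.Dir) : List H.Dir :=
  match T.index d with
  | some i => P i
  | none => []

theorem pre_of_some {P : Fin n → List H.Dir} {d : G.Dir} {i : Fin n} (h : T.index d = some i) :
    T.pre P d = P i := by rw [pre, h]

theorem pre_of_none {P : Fin n → List H.Dir} {d : G.Dir} (h : T.index d = none) :
    T.pre P d = [] := by rw [pre, h]

theorem wordLength_pre {ℓ : H.E → ℝ} {μ : ℝ} {t : Fin n → ℝ} {P : Fin n → List H.Dir}
    (hP : ∀ i, wordLength ℓ (P i) = μ * t i) (d : G.Dir) :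
    wordLength ℓ (T.pre P d) = μ * T.amount t d := by
  cases h : T.index d with
  | none => simp [T.pre_of_none h, T.amount_of_none h]
  | some i => rw [T.pre_of_some h, T.amount_of_some h, hP]

theorem pre_prefix {F : PathMap G H} {P : Fin n → List H.Dir} (ha : ∀ i, P i <+: F.onDir (T.a i))
    (hb : ∀ i, P i <+: F.onDir (T.b i)) (d : G.Dir) : T.pre P d <+: F.onDir d := by
  cases h : T.index d with
  | none => rw [T.pre_of_none h]; exact List.nil_prefix
  | some i =>
    rw [T.pre_of_some h]
    rcases T.index_eq_some.1 h with rfl | rfl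
    · exact ha i
    · exact hb i

variable {T} in
/-- A map that identifies initial segments of both directions of every turn factors through the
fold of these segments. -/
theorem exists_factor {F : PathMap G H} {P : Fin n → List H.Dir} {m : G.E → List H.Dir}
    (ha : ∀ i, P i <+: F.onDir (T.a i))
    (hm : ∀ e, F.onDir (e, true) =
      T.pre P (e, true) ++ m e ++ FreeGroup.invRev (T.pre P (e, false))) :
    ∃ g : PathMap T.foldGraph H, (∀ v, g.onV (Sum.inl v) = F.onV v) ∧
      (∀ e, g.onDir (Sum.inl e, true) = m e) ∧ (∀ i, g.onDir (T.new i) = P i) ∧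
      ∀ d, g.onPath (T.fold.onDir d) = F.onDir d := by
  -- The new vertex `i` is the endpoint of the folded segment, so it must go to the endpoint of the
  -- prefix `P i`.
  let oV : T.foldGraph.V → H.V :=
    Sum.elim F.onV fun i => pathEnd (F.onV (init (T.a i))) (P i)
  have hoV : ∀ d, oV (T.foldInit d) = pathEnd (F.onV (init d)) (T.pre P d) := by
    intro d
    cases h : T.index d with
    | none => rw [T.foldInit_of_none h, T.pre_of_none h]; rfl
    | some i => rw [T.foldInit_of_some h, T.pre_of_some h, T.init_eq_of_index h]; rfl
  have hpath : ∀ e, IsPath (oV (T.foldInit (e, true))) (oV (T.foldInit (e, false))) (m e) := by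
    intro e
    have h := F.isPath_onDir (e, true)
    rw [hm, List.append_assoc] at h
    obtain ⟨-, h1⟩ := isPath_append_iff_pathEnd h
    rw [← hoV] at h1
    have h2 := h1.invRev
    rw [FreeGroup.invRev_append, FreeGroup.invRev_invRev] at h2
    obtain ⟨-, h3⟩ := isPath_append_iff_pathEnd h2
    have h4 : pathEnd (F.onV (term (e, true))) (T.pre P (e, false)) = oV (T.foldInit (e, false)) :=
      (hoV (e, false)).symm
    rw [h4] at h3
    simpa using h3.invRev
  let g : PathMap T.foldGraph H := PathMap.ofEdges oV
    (fun x => Sum.elim m P x) (by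
      rintro (e | i)
      · exact hpath e
      · obtain ⟨q, hq⟩ := ha i
        have h := F.isPath_onDir (T.a i)
        rw [← hq] at h
        exact (isPath_append_iff_pathEnd h).1)
  have hstart : ∀ d, g.onPath (T.start d) = T.pre P d := by
    intro d
    cases h : T.index d with
    | none => rw [T.start_of_none h, T.pre_of_none h]; rfl
    | some i => rw [T.start_of_some h, T.pre_of_some h]; exact List.append_nil _
  have htrue : ∀ e, g.onPath (T.fold.onDir (e, true)) = F.onDir (e, true) := by
    intro e
    rw [fold_onDir, PathMap.onPath_append, PathMap.onPath_cons, PathMap.onPath_invRev, hstart,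
      hstart, hm, List.append_assoc]
    rfl
  refine ⟨g, fun _ => rfl, fun _ => rfl, fun _ => rfl, fun d => ?_⟩
  obtain ⟨e, _ | _⟩ := d
  · change g.onPath (T.fold.onDir (rev (e, true))) = F.onDir (rev (e, true))
    rw [PathMap.onDir_rev, PathMap.onDir_rev, PathMap.onPath_invRev, htrue]
  · exact htrue e

end TurnFamily

end FoldedTrainTrack

end FinGraph

/-- If a train track map `F` with stretch factor `μ` identifies initial segments of length `t i` of
the directions `a i` and `b i`, with endpoints mapping to vertices, then it induces a train track
map on the folded graph. -/
theorem mem_TT_of_prefixes {N n : ℕ} {M : MarkedGraph N} {T : TurnFamily M.toFinGraph n}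
    {F : PathMap M.toFinGraph M.toFinGraph} {φ : MulAut (FreeGroup (Fin N))}
    (hrep : ∃ p : List M.toFinGraph.Dir, IsPath M.base (F.onV M.base) p ∧
      ∀ x, FreeGroup.mk p * F.onFree (M.marking x) * (FreeGroup.mk p)⁻¹ = M.marking (φ x))
    (hF : ∀ m d, FreeGroup.IsReduced (F.onPath^[m] [d]))
    {ℓ : M.E → ℝ} {δ μ : ℝ} (hδ : 0 < δ) (hℓ : ∀ e, 2 * δ ≤ ℓ e) (hvol : ∑ e, ℓ e = 1) (hμ : 1 < μ)
    (hFℓ : ∀ d, wordLength ℓ (F.onDir d) = μ * ℓ d.1)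
    {t : Fin n → ℝ} (ht : ∀ i, 0 < t i ∧ t i < δ) (hsum : ∑ i, t i < 1)
    {P : Fin n → List M.toFinGraph.Dir} (ha : ∀ i, P i <+: F.onDir (T.a i))
    (hb : ∀ i, P i <+: F.onDir (T.b i)) (hP : ∀ i, wordLength ℓ (P i) = μ * t i)
    {Y : OuterSpace N} (hY : IsSimultaneousFold M ℓ T.a T.b t Y) : Y ∈ TT φ := by
  have hpos : ∀ e, 0 < ℓ e := fun e => by linarith [hℓ e]
  have hμ0 : 0 < μ := by linarith
  have hc : 0 < 1 - ∑ i, t i := by linarith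
  -- The part of each edge that is left after folding has positive length, so its image is a
  -- nonempty middle piece.
  have hmid : ∀ e, ∃ m, m ≠ [] ∧ F.onDir (e, true) =
      T.pre P (e, true) ++ m ++ FreeGroup.invRev (T.pre P (e, false)) := by
    intro e
    refine exists_middle hpos (T.pre_prefix ha hb _) ?_ ?_
    · have h : F.onDir (e, true) = FreeGroup.invRev (F.onDir (e, false)) := F.onDir_rev (e, false)
      obtain ⟨q, hq⟩ := T.pre_prefix ha hb (e, false)
      rw [h, ← hq, FreeGroup.invRev_append]
      exact List.suffix_append _ _
    · rw [wordLength_invRev, T.wordLength_pre hP, T.wordLength_pre hP, hFℓ, ← mul_add]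
      refine mul_lt_mul_of_pos_left ?_ hμ0
      have h1 := T.amount_lt hδ (fun i => (ht i).2) (e, true)
      have h2 := T.amount_lt hδ (fun i => (ht i).2) (e, false)
      have h3 := hℓ e
      dsimp only
      linarith
  choose m hm0 hm using hmid
  obtain ⟨g, hgV, hgold, hgnew, hgfold⟩ := TurnFamily.exists_factor ha hm
  have hP0 : ∀ i, P i ≠ [] := fun i h => by
    have := hP i
    rw [h, wordLength_nil] at this
    exact absurd this (mul_pos hμ0 (ht i).1).ne
  have hgfoldP : ∀ p, g.onPath (T.fold.onPath p) = F.onPath p := by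
    intro p
    induction p with
    | nil => rfl
    | cons d p ih => rw [PathMap.onPath_cons, PathMap.onPath_append, ih, hgfold]; rfl
  have hgne : ∀ x, g.onDir x ≠ [] := by
    have h1 : ∀ x : T.foldGraph.E, g.onDir (x, true) ≠ [] := by
      rintro (e | i)
      · rw [hgold]; exact hm0 e
      · exact (hgnew i).symm ▸ hP0 i
    rintro ⟨x, _ | _⟩
    · have h2 : g.onDir (x, false) = FreeGroup.invRev (g.onDir (x, true)) := g.onDir_rev (x, true)
      rw [h2]
      intro h3
      exact h1 x (by simpa using congrArg FreeGroup.invRev h3)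
    · exact h1 x
  have hginfix : ∀ x : T.foldGraph.E, ∃ d, g.onDir (x, true) <:+: F.onDir d := by
    rintro (e | i)
    · exact ⟨(e, true), by rw [hgold, hm]; exact ⟨_, _, rfl⟩⟩
    · exact ⟨T.a i, by
        have : g.onDir (T.new i) = P i := hgnew i
        exact (this ▸ (ha i).isInfix)⟩
  -- From `g ∘ fold = F` one gets `(fold ∘ g)^(k+1) = fold ∘ F^k ∘ g`.
  have hiter : ∀ (k : ℕ) x, (g.comp T.fold).onPath^[k + 1] [x] =
      T.fold.onPath (F.onPath^[k] (g.onDir x)) := by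
    intro k x
    induction k with
    | zero => rw [Function.iterate_one, PathMap.comp_onPath, PathMap.onPath_cons, PathMap.onPath_nil,
        List.append_nil]; rfl
    | succ k ih =>
      rw [Function.iterate_succ_apply', ih, PathMap.comp_onPath, hgfoldP,
        Function.iterate_succ_apply']
  have htt : (g.comp T.fold).toGraphMap.IsTrainTrack := by
    refine ⟨fun x => ?_, fun k x hk => ?_⟩
    · change T.fold.onPath (g.onDir (x, true)) ≠ []
      obtain ⟨d, q, hq⟩ := List.exists_cons_of_ne_nil (hgne (x, true))
      rw [hq, PathMap.onPath_cons, TurnFamily.fold_onDir]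
      simp
    · obtain ⟨k, rfl⟩ := Nat.exists_eq_add_of_le' hk
      rw [PathMap.toGraphMap_onPath, hiter]
      obtain ⟨d, hd⟩ := hginfix x
      -- The image of an edge under `g` is a subpath of some `F d`. Applying `g` once more yields a
      -- subpath of `F^(k+2) d`, which is reduced; as `g` collapses no edge, the path before this
      -- last application was reduced too.
      have h1 := T.fold.onPath_infix (F.onPath_iterate_infix hd k)
      refine FreeGroup.IsReduced.infix (g.isReduced_of_onPath hgne ?_) h1
      have h2 : F.onPath [d] = F.onDir d := List.append_nil _
      rw [hgfoldP, ← h2, ← Function.iterate_succ_apply, ← Function.iterate_succ_apply' F.onPath]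
      exact hF _ _
  have hmat : (g.comp T.fold).toGraphMap.transitionMatrix.mulVec (foldLength T.a T.b ℓ t) =
      μ • foldLength T.a T.b ℓ t := by
    funext x
    rw [GraphMap.transitionMatrix_mulVec]
    change wordLength _ (T.fold.onPath (g.onDir (x, true))) = μ * _
    rw [PathMap.onPath, wordLength_flatMap ℓ _ _ _ (T.wordLength_fold_onDir ℓ t)]
    rcases x with e | i
    · have h1 := hFℓ (e, true)
      rw [hm, wordLength_append, wordLength_append, wordLength_invRev, T.wordLength_pre hP,
        T.wordLength_pre hP] at h1
      rw [hgold, T.foldLength_inl]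
      field_simp
      dsimp only at h1
      linarith
    · have h1 : g.onDir (Sum.inr i, true) = P i := hgnew i
      rw [h1, hP, foldLength]
      field_simp
  have hrep' : ∃ p : List T.foldGraph.Dir,
      IsPath (Sum.inl M.base) ((g.comp T.fold).toGraphMap.onV (Sum.inl M.base)) p ∧
      ∀ x, FreeGroup.mk p * (g.comp T.fold).onFree (foldHom T.a T.b (M.marking x)) *
        (FreeGroup.mk p)⁻¹ = foldHom T.a T.b (M.marking (φ x)) := by
    obtain ⟨p, hp, hpx⟩ := hrep
    refine ⟨T.fold.onPath p, ?_, fun x => ?_⟩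
    · have h2 : (g.comp T.fold).toGraphMap.onV (Sum.inl M.base) = T.fold.onV (F.onV M.base) :=
        congrArg Sum.inl (hgV M.base)
      rw [h2]
      exact T.fold.isPath_onPath hp
    · rw [← hpx, T.foldHom_eq, map_mul, map_mul, map_inv, PathMap.onFree_mk]
      congr 2
      obtain ⟨q, hq⟩ : ∃ q, FreeGroup.mk q = M.marking x :=
        ⟨(M.marking x).toWord, FreeGroup.mk_toWord⟩
      rw [← hq, PathMap.onFree_mk, PathMap.onFree_mk, PathMap.onFree_mk, PathMap.onFree_mk,
        PathMap.comp_onPath, hgfoldP]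
  exact ⟨M.fold T, foldLength T.a T.b ℓ t, (g.comp T.fold).toGraphMap, htt,
    ⟨T.foldLength_pos hδ hℓ ht hsum, T.sum_foldLength hvol hsum, μ, hμ, hmat⟩, hrep', hY⟩

namespace FinGraph

/-! ### Nonbacktracking walks -/

section Turns

variable {G : FinGraph}

/-- `d'` may follow `d` in a path without backtracking. -/
def Turn (d d' : G.Dir) : Prop := init d' = term d ∧ d' ≠ rev d

theorem Turn.reverse {d d' : G.Dir} (h : Turn d d') : Turn (rev d') (rev d) :=
  ⟨by rw [init_rev, term_rev, h.1], fun e => h.2 (by rw [e, rev_rev])⟩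

theorem turn_rev_left {x y : G.Dir} (h : init x = init y) (hne : x ≠ y) : Turn (FinGraph.rev x) y :=
  ⟨by rw [term_rev, h], by rw [rev_rev]; exact hne.symm⟩

theorem two_le_valence_term (hval : ∀ v : G.V, valence v ≠ 1) (d : G.Dir) :
    2 ≤ valence (term d) := by
  have h0 : valence (term d) ≠ 0 := by
    rw [valence_eq_card, Ne, Finset.card_eq_zero, ← Ne, ← Finset.nonempty_iff_ne_empty]
    exact ⟨rev d, by simp⟩
  have h1 := hval (term d)
  omega

open Classical in
/-- Transition probabilities of the nonbacktracking random walk. -/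
noncomputable def turnProb (d d' : G.Dir) : ℝ :=
  if Turn d d' then ((valence (term d) : ℝ) - 1)⁻¹ else 0

theorem turnProb_pos (hval : ∀ v : G.V, valence v ≠ 1) {d d' : G.Dir} (h : Turn d d') :
    0 < turnProb d d' := by
  rw [turnProb, if_pos h, inv_pos]
  have : (2 : ℝ) ≤ valence (term d) := by exact_mod_cast two_le_valence_term hval d
  linarith

theorem turnProb_nonneg (hval : ∀ v : G.V, valence v ≠ 1) (d d' : G.Dir) :
    0 ≤ turnProb d d' := by
  by_cases h : Turn d d'
  · exact (turnProb_pos hval h).le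
  · rw [turnProb, if_neg h]

theorem sum_turnProb (hval : ∀ v : G.V, valence v ≠ 1) (d : G.Dir) :
    ∑ d', turnProb d d' = 1 := by
  classical
  have h2 := two_le_valence_term hval d
  have h2' : (2 : ℝ) ≤ valence (term d) := by exact_mod_cast h2
  have hcard : (Finset.univ.filter fun d' : G.Dir => Turn d d').card = valence (term d) - 1 := by
    rw [valence_eq_card, ← Finset.card_erase_of_mem (a := rev d) (by simp)]
    congr 1
    ext x
    simp [Turn, and_comm]
  simp only [turnProb]
  rw [← Finset.sum_filter, Finset.sum_const, hcard, nsmul_eq_mul, Nat.cast_sub (by omega),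
    Nat.cast_one]
  exact mul_inv_cancel₀ (by linarith)

theorem turnProb_rev (d d' : G.Dir) : turnProb (rev d') (rev d) = turnProb d d' := by
  by_cases h : Turn d d'
  · rw [turnProb, turnProb, if_pos h, if_pos h.reverse, term_rev, h.1]
  · rw [turnProb, turnProb, if_neg h, if_neg fun h' => h (by simpa using h'.reverse)]

theorem sum_turnProb_left (hval : ∀ v : G.V, valence v ≠ 1) (d' : G.Dir) :
    ∑ d, turnProb d d' = 1 := by
  rw [← sum_turnProb hval (rev d')]
  refine Finset.sum_bij' (fun d _ => rev d) (fun d _ => rev d) ?_ ?_ ?_ ?_ ?_ <;>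
    simp [turnProb_rev]

/-- The nonbacktracking random walk preserves the uniform measure, so that a set it cannot leave is
one it cannot enter. -/
theorem mem_of_turn (hval : ∀ v : G.V, valence v ≠ 1) {S : Set G.Dir}
    (hS : ∀ d ∈ S, ∀ d', Turn d d' → d' ∈ S) {d d' : G.Dir} (h : Turn d d') (hd' : d' ∈ S) :
    d ∈ S := by
  classical
  by_contra hd
  set A := Finset.univ.filter (· ∈ S) with hA
  have hmem : ∀ x, x ∈ A ↔ x ∈ S := by simp [hA]
  -- Column sums give the total flow into `A`; row sums give the flow from `A` to itself, as nothing
  -- leaves `A`. Both equal the size of `A`, so a transition from `d` outside `A` would be in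
  -- excess.
  have h1 : ∑ y ∈ A, ∑ x, turnProb x y = A.card := by simp [sum_turnProb_left hval]
  have h2 : ∑ x ∈ A, ∑ y ∈ A, turnProb x y = A.card := by
    rw [Finset.card_eq_sum_ones, Nat.cast_sum, Nat.cast_one]
    refine Finset.sum_congr rfl fun x hx => ?_
    rw [← sum_turnProb hval x]
    refine Finset.sum_subset (Finset.subset_univ _) fun y _ hy => ?_
    rw [turnProb, if_neg]
    exact fun ht => hy ((hmem y).2 (hS x ((hmem x).1 hx) y ht))
  rw [Finset.sum_comm] at h2
  have h3 : ∑ y ∈ A, ∑ x ∈ A, turnProb x y < ∑ y ∈ A, ∑ x, turnProb x y := by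
    refine Finset.sum_lt_sum (fun y _ => Finset.sum_le_sum_of_subset_of_nonneg
      (Finset.subset_univ _) fun x _ _ => turnProb_nonneg hval x y) ⟨d', (hmem d').2 hd', ?_⟩
    exact Finset.sum_lt_sum_of_subset (Finset.subset_univ _) (Finset.mem_univ d)
      (fun hx => hd ((hmem d).1 hx)) (turnProb_pos hval h) fun x _ _ => turnProb_nonneg hval x d'
  linarith

/-- `TurnWalk d p d'`: the list `p` of directions continues `d` without backtracking and ends with
`d'`. -/
def TurnWalk : G.Dir → List G.Dir → G.Dir → Prop
  | d, [], d' => d = d'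
  | d, x :: p, d' => Turn d x ∧ TurnWalk x p d'

theorem TurnWalk.append {d x d' : G.Dir} {p q : List G.Dir} (hp : TurnWalk d p x)
    (hq : TurnWalk x q d') : TurnWalk d (p ++ q) d' := by
  induction p generalizing d with
  | nil => cases hp; exact hq
  | cons y p ih => exact ⟨hp.1, ih hp.2⟩

theorem Turn.turnWalk {d d' : G.Dir} (h : Turn d d') : TurnWalk d [d'] d' := ⟨h, rfl⟩

theorem TurnWalk.isPath {d d' : G.Dir} {p : List G.Dir} (h : TurnWalk d p d') :
    IsPath (term d) (term d') p := by
  induction p generalizing d with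
  | nil => exact congrArg term h
  | cons x p ih => exact ⟨h.1.1, ih h.2⟩

theorem Turn.eq_of_fst_eq {d d' : G.Dir} (h : Turn d d') (e : d.1 = d'.1) : d.2 = d'.2 := by
  by_contra hne
  refine h.2 (Prod.ext e.symm ?_)
  rw [rev]
  revert hne
  cases d.2 <;> cases d'.2 <;> simp

theorem TurnWalk.isChain {d d' : G.Dir} {p : List G.Dir} (h : TurnWalk d p d') :
    FreeGroup.IsReduced (d :: p) := by
  induction p generalizing d with
  | nil => exact FreeGroup.IsReduced.singleton
  | cons x p ih => exact List.isChain_cons_cons.2 ⟨h.1.eq_of_fst_eq, ih h.2⟩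

theorem TurnWalk.getLast?_eq {d d' : G.Dir} {p : List G.Dir} (h : TurnWalk d p d') :
    (d :: p).getLast? = some d' := by
  induction p generalizing d with
  | nil => cases h; rfl
  | cons x p ih => rw [List.getLast?_cons_cons]; exact ih h.2

/-- The walk ends with `d` and its first letter continues `d`, so nothing cancels when it is closed
up. -/
theorem TurnWalk.isCyclicallyReduced {d : G.Dir} {p : List G.Dir} (h : TurnWalk d p d) :
    FreeGroup.IsCyclicallyReduced p := by
  cases p with
  | nil => exact FreeGroup.IsCyclicallyReduced.nil
  | cons x p =>
    refine ⟨h.2.isChain, fun a ha b hb => ?_⟩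
    rw [h.2.getLast?_eq] at ha
    cases ha
    cases hb
    exact h.1.eq_of_fst_eq

theorem exists_turnWalk_symm (hval : ∀ v : G.V, valence v ≠ 1) {d d' : G.Dir} {p : List G.Dir}
    (h : TurnWalk d p d') : ∃ q, TurnWalk d' q d := by
  induction p generalizing d with
  | nil => cases h; exact ⟨[], rfl⟩
  | cons x p ih =>
    obtain ⟨q, hq⟩ := ih h.2
    exact mem_of_turn hval (S := {y | ∃ q, TurnWalk d' q y})
      (fun y ⟨q, hq⟩ z hz => ⟨_, hq.append hz.turnWalk⟩) h.1 ⟨q, hq⟩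

/-- A weight that sums to zero along all closed nonbacktracking walks is a coboundary. -/
theorem exists_potential (hval : ∀ v : G.V, valence v ≠ 1) {u : G.E → ℝ}
    (hu : ∀ d p, TurnWalk d p d → wordLength u p = 0) :
    ∃ h : G.Dir → ℝ, ∀ d d', Turn d d' → h d' = h d + u d'.1 := by
  -- Reachability is symmetric by `exists_turnWalk_symm`. The potential of `d` is the weight of a
  -- walk to `d` from a fixed representative of its class.
  let s : Setoid G.Dir :=
    { r := fun d d' => ∃ p, TurnWalk d p d'
      iseqv := ⟨fun d => ⟨[], rfl⟩, fun ⟨_, hp⟩ => exists_turnWalk_symm hval hp,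
        fun ⟨_, hp⟩ ⟨_, hq⟩ => ⟨_, hp.append hq⟩⟩ }
  have hrep : ∀ d, ∃ p, TurnWalk (Quotient.mk s d).out p d := fun d => Quotient.mk_out (s := s) d
  choose p hp using hrep
  refine ⟨fun d => wordLength u (p d), fun d d' h => ?_⟩
  have hrep : Quotient.mk s d = Quotient.mk s d' := Quotient.sound ⟨_, h.turnWalk⟩
  obtain ⟨q, hq⟩ := exists_turnWalk_symm hval (hp d')
  -- The chosen walk to `d'` and the one passing through `d` are closed up by the same `q`, so they
  -- have equal weight.
  have h1 := hu _ _ ((hp d').append hq)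
  have h2 := (hp d).append h.turnWalk
  rw [hrep] at h2
  have h3 := hu _ _ (h2.append hq)
  simp only [wordLength_append, wordLength_cons, wordLength_nil] at h1 h3
  linarith

end Turns

end FinGraph

/-- If the length function of a marked graph with (arbitrary real) edge weights `u` vanishes, then
`u` comes from weights on the half-edges which sum to zero at every turn. -/
theorem exists_halfEdge_weights {N : ℕ} (M : MarkedGraph N) {u : M.E → ℝ}
    (hu : ∀ x, lengthFunction M.marking u x = 0) :
    ∃ D : M.toFinGraph.Dir → ℝ, (∀ x, D x + D (rev x) = 2 * u x.1) ∧
      ∀ x y, init x = init y → x ≠ y → D x + D y = 0 := by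
  have hcyc : ∀ (d : M.toFinGraph.Dir) p, TurnWalk d p d → wordLength u p = 0 := by
    intro d p hp
    obtain ⟨q, hq⟩ := M.connected.2 M.base (term d)
    -- Joining the closed walk to the base point only conjugates it, which does not change its
    -- translation length.
    have hmem : FreeGroup.mk (q ++ (p ++ FreeGroup.invRev q)) ∈ Set.range M.marking := by
      rw [M.range_marking]
      exact ⟨_, hq.append (hp.isPath.append hq.invRev), rfl⟩
    obtain ⟨x, hx⟩ := hmem
    have h := hu x
    rw [lengthFunction_eq, hx, ← FreeGroup.mul_mk, ← FreeGroup.mul_mk, ← FreeGroup.inv_mk,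
      ← mul_assoc, translationLength_conj, translationLength_mk _ hp.isCyclicallyReduced] at h
    exact h
  obtain ⟨h, hh⟩ := exists_potential M.valence_ne_one hcyc
  -- The potential differences cancel in `D x + D (rev x)`. At a turn, the potential relations for
  -- `rev x` followed by `y` and for `rev y` followed by `x` add up to `D x + D y = 0`.
  refine ⟨fun x => h (rev x) - h x + u x.1, fun x => ?_, fun x y hxy hne => ?_⟩
  · have : (rev x).1 = x.1 := rfl
    simp only [rev_rev, this]
    ring
  · have h1 := hh _ _ (turn_rev_left hxy hne)
    have h2 := hh _ _ (turn_rev_left hxy.symm hne.symm)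
    simp only
    linarith

namespace FinGraph

/-! ### Folding lengths are determined by the folded metric graph -/

section HalfEdges

variable {G : FinGraph}

theorem vertex_induction (hG : G.IsConnected) {S : G.V → Prop} {v : G.V} (hv : S v)
    (h : ∀ x : G.Dir, S (init x) → S (term x)) (w : G.V) : S w := by
  obtain ⟨p, hp⟩ := hG.2 v w
  clear hG
  induction p generalizing v with
  | nil => cases hp; exact hv
  | cons x p ih =>
    obtain ⟨rfl, hp⟩ := hp
    exact ih (h x hv) hp

/-- In a graph which is not a circle, one comes to an endpoint of a topological edge by going
straight on. -/
theorem exists_continues_valence_ne_two (hG : G.IsConnected) (hval : ∀ v : G.V, valence v ≠ 1)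
    {v : G.V} (hv : valence v ≠ 2) (x : G.Dir) :
    ∃ d, Relation.ReflTransGen Continues x d ∧ valence (term d) ≠ 2 := by
  by_contra! hall
  set S : Set G.Dir := {d | Relation.ReflTransGen Continues x d}
  -- If all ends had valence two, going straight would be the only way to continue without
  -- backtracking, so `S` would be closed under turns and, by `mem_of_turn`, under going backwards.
  -- Connectedness then makes every vertex, including `v`, an end of a direction in `S`.
  have hS : ∀ d ∈ S, ∀ d', Turn d d' → d' ∈ S := fun d hd d' h =>
    Relation.ReflTransGen.tail hd ⟨h.1, hall d hd, h.2⟩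
  obtain ⟨d, hd, hdv⟩ := vertex_induction hG (S := fun w => ∃ d ∈ S, term d = w)
    ⟨x, Relation.ReflTransGen.refl, rfl⟩ (fun y ⟨d, hd, hy⟩ => by
      by_cases hyd : y = rev d
      · obtain ⟨z, hz, hzd⟩ := valence_ne_one_iff.1 (hval (init d)) d rfl
        exact ⟨rev z, mem_of_turn hval hS (turn_rev_left hz hzd) hd, by rw [hyd, term_rev, term_rev, hz]⟩
      · exact ⟨y, hS d hd y ⟨hy.symm, hyd⟩, rfl⟩) v
  exact hv (hdv ▸ hall d hd)

theorem eq_zero_of_three_le_valence {D : G.Dir → ℝ} {x : G.Dir} (hx : 3 ≤ valence (init x))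
    (hD : ∀ y z, init y = init x → init z = init x → y ≠ z → D y + D z = 0) : D x = 0 := by
  rw [valence_eq_card] at hx
  have hmem : x ∈ Finset.univ.filter fun d : G.Dir => init d = init x := by simp
  obtain ⟨y, hy, z, hz, hyz⟩ := Finset.one_lt_card.1
    (show 1 < ((Finset.univ.filter fun d : G.Dir => init d = init x).erase x).card by
      rw [Finset.card_erase_of_mem hmem]; omega)
  simp only [Finset.mem_erase, Finset.mem_filter, Finset.mem_univ, true_and] at hy hz
  linarith [hD x y rfl hy.2 hy.1.symm, hD x z rfl hz.2 hz.1.symm, hD y z hy.2 hz.2 hyz]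

/-- At a vertex of valence two the weights are opposite, so crossing it and the next edge adds `2 *
κ * ℓ > 0` to the weight at the far end. -/
theorem continues_le {D : G.Dir → ℝ} {ℓ : G.E → ℝ} {κ : ℝ} (hℓ : ∀ e, 0 < ℓ e) (hκ : 0 < κ)
    (hrev : ∀ x, D x + D (rev x) = 2 * (κ * ℓ x.1))
    (htwo : ∀ x y, valence (init x) = 2 → init x = init y → x ≠ y → D x + D y = 0)
    {x d : G.Dir} (h : Relation.ReflTransGen Continues x d) : D (rev x) ≤ D (rev d) := by
  induction h with
  | refl => exact le_rfl
  | tail _ hc ih =>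
    rename_i d d' _
    refine ih.trans ?_
    have h1 := htwo d' (rev d) (by rw [hc.1]; exact hc.2.1) hc.1 hc.2.2
    have h2 := hrev d'
    have h3 := mul_pos hκ (hℓ d'.1)
    linarith

end HalfEdges

namespace TurnFamily

variable {G : FinGraph} {n : ℕ} (T : TurnFamily G n)

/-- Half-edge weights which express that `κ * ℓ` agrees, on all closed paths without backtracking,
with `2 * r i` for every crossing of the turn number `i`. -/
structure Balanced (ℓ : G.E → ℝ) (κ : ℝ) (r : Fin n → ℝ) (D : G.Dir → ℝ) : Prop where
  add_rev : ∀ x, D x + D (rev x) = 2 * (κ * ℓ x.1)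
  add_eq_zero : ∀ x y, (∀ i, init x ≠ init (T.a i)) → init x = init y → x ≠ y → D x + D y = 0
  abs_eq : ∀ i x, init x = init (T.a i) → |D x| = 2 * |r i|

variable {T} {ℓ : G.E → ℝ} {κ : ℝ} {r : Fin n → ℝ} {D : G.Dir → ℝ}

/-- Only `|r i|` enters, so the sign of `κ` can be flipped with `r` unchanged; this reduces `κ = 0`
to `¬ 0 < κ`. -/
theorem Balanced.neg (h : T.Balanced ℓ κ r D) : T.Balanced ℓ (-κ) r fun x => -D x where
  add_rev x := by linarith [h.add_rev x]
  add_eq_zero x y h1 h2 h3 := by linarith [h.add_eq_zero x y h1 h2 h3]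
  abs_eq i x hx := by rw [abs_neg, h.abs_eq i x hx]

theorem Balanced.eq_zero_of_valence (h : T.Balanced ℓ κ r D) (hval : ∀ v : G.V, valence v ≠ 1)
    {x : G.Dir} (hx : ∀ i, init x ≠ init (T.a i)) (hx2 : valence (init x) ≠ 2) : D x = 0 := by
  have h2 := two_le_valence_term hval (rev x)
  rw [term_rev] at h2
  exact eq_zero_of_three_le_valence (by omega) fun y z hy hz hyz =>
    h.add_eq_zero y z (fun i => hy ▸ hx i) (hy.trans hz.symm) hyz

/-- The index `i₀` provides a vertex of valence three, so the graph is not a circle and the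
topological edge of `e₀` has an endpoint in either direction. That endpoint is none of the turn
vertices, hence carries weight zero. -/
theorem Balanced.exists_eq_zero (h : T.Balanced ℓ κ r D) (hG : G.IsConnected)
    (hval : ∀ v : G.V, valence v ≠ 1) (i₀ : Fin n) {e₀ : G.E}
    (he₀ : ∀ i, ¬ TopIncident e₀ (init (T.a i))) (b : Bool) :
    ∃ d, Relation.ReflTransGen Continues (e₀, b) d ∧ D (rev d) = 0 := by
  obtain ⟨d, hd, hd2⟩ := exists_continues_valence_ne_two hG hval
    (v := init (T.a i₀)) (by rw [T.valence_eq]; decide) (e₀, b)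
  exact ⟨d, hd, h.eq_zero_of_valence hval (fun i hi => he₀ i ⟨b, d, hd, hi⟩) hd2⟩

theorem Balanced.not_pos (h : T.Balanced ℓ κ r D) (hG : G.IsConnected)
    (hval : ∀ v : G.V, valence v ≠ 1) (hℓ : ∀ e, 0 < ℓ e) (i₀ : Fin n) {e₀ : G.E}
    (he₀ : ∀ i, ¬ TopIncident e₀ (init (T.a i))) : ¬ 0 < κ := by
  intro hκ
  -- The weight is zero at both far ends of the topological edge and only grows on the way there, so
  -- it is nonpositive at both ends of `e₀`, although these two weights add up to `2 * κ * ℓ e₀ >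
  -- 0`.
  have hle : ∀ b, D (rev (e₀, b)) ≤ 0 := by
    intro b
    obtain ⟨d, hd, hd0⟩ := h.exists_eq_zero hG hval i₀ he₀ b
    rw [← hd0]
    refine continues_le hℓ hκ h.add_rev (fun x y h2 hxy hne => ?_) hd
    refine h.add_eq_zero x y (fun i hi => ?_) hxy hne
    rw [hi, T.valence_eq] at h2
    omega
  have h1 := hle true
  have h2 : D (e₀, true) ≤ 0 := hle false
  have h3 := h.add_rev (e₀, true)
  have h4 := mul_pos hκ (hℓ e₀)
  dsimp only at h3
  linarith

theorem Balanced.kappa_eq_zero (h : T.Balanced ℓ κ r D) (hG : G.IsConnected)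
    (hval : ∀ v : G.V, valence v ≠ 1) (hℓ : ∀ e, 0 < ℓ e) (i₀ : Fin n) {e₀ : G.E}
    (he₀ : ∀ i, ¬ TopIncident e₀ (init (T.a i))) : κ = 0 := by
  have h1 := h.not_pos hG hval hℓ i₀ he₀
  have h2 := h.neg.not_pos hG hval hℓ i₀ he₀
  linarith

/-- For `κ = 0` the absolute value of `D` is the same at both ends of an edge and at all directions
of a vertex, hence constant on the connected graph. -/
theorem Balanced.eq_zero (h : T.Balanced ℓ 0 r D) (hG : G.IsConnected) {z : G.Dir} (hz : D z = 0)
    (i : Fin n) : r i = 0 := by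
  have hvert : ∀ x y, init x = init y → |D x| = |D y| := by
    intro x y hxy
    by_cases hx : ∃ i, init x = init (T.a i)
    · obtain ⟨i, hi⟩ := hx
      rw [h.abs_eq i x hi, h.abs_eq i y (hxy ▸ hi)]
    · push Not at hx
      by_cases hne : x = y
      · rw [hne]
      · rw [eq_neg_of_add_eq_zero_left (h.add_eq_zero x y hx hxy hne), abs_neg]
  have hedge : ∀ x, |D (rev x)| = |D x| := by
    intro x
    have := h.add_rev x
    rw [zero_mul, mul_zero] at this
    rw [eq_neg_of_add_eq_zero_left this, abs_neg]
  have hall := vertex_induction hG (S := fun w => ∀ x, init x = w → D x = 0) (v := init z)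
    (fun x hx => by rw [← abs_eq_zero, hvert x z hx, hz, abs_zero])
    (fun y hy x hx => by
      rw [← abs_eq_zero, hvert x (rev y) hx, hedge, hy y rfl, abs_zero]) (init (T.a i))
  have h1 := h.abs_eq i (T.a i) rfl
  rw [hall _ rfl, abs_zero] at h1
  exact abs_eq_zero.1 (by linarith)

end TurnFamily

end FinGraph

/-! ### Equal folded length functions and equal folding lengths -/

section Injectivity

variable {N n : ℕ} {M : MarkedGraph N} {T : TurnFamily M.toFinGraph n} {ℓ : M.E → ℝ}
  {t t' : Fin n → ℝ}

/-- The length function of the metric graph obtained by folding the turns by the lengths `t`. -/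
noncomputable def foldedLengthFunction (M : MarkedGraph N) (T : TurnFamily M.toFinGraph n)
    (ℓ : M.E → ℝ) (t : Fin n → ℝ) : FreeGroup (Fin N) → ℝ :=
  lengthFunction ((foldHom T.a T.b).comp M.marking) (foldLength T.a T.b ℓ t)

theorem exists_balanced (ht : ∑ i, t i < 1) (ht' : ∑ i, t' i < 1)
    (h : foldedLengthFunction M T ℓ t = foldedLengthFunction M T ℓ t') :
    ∃ D, T.Balanced ℓ (∑ i, t i - ∑ i, t' i)
      (fun i => (1 - ∑ i, t' i) * t i - (1 - ∑ i, t i) * t' i) D := by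
  set c := 1 - ∑ i, t i with hc
  set c' := 1 - ∑ i, t' i with hc'
  have hc0 : c ≠ 0 := by linarith
  have hc0' : c' ≠ 0 := by linarith
  set r : Fin n → ℝ := fun i => c' * t i - c * t' i with hr
  have hamount : ∀ d, T.amount r d = c' * T.amount t d - c * T.amount t' d := by
    intro d
    cases hd : T.index d with
    | none => simp [T.amount_of_none hd]
    | some i => simp [T.amount_of_some hd, hr]
  -- Both metrics live on the same marked graph, and length is linear in the weights, so the
  -- difference has vanishing length function. The factor `c' * c` clears the denominators of the
  -- rescalings.
  set u : M.E ⊕ Fin n → ℝ := fun x => c' * c * foldLength T.a T.b ℓ t x -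
    c' * c * foldLength T.a T.b ℓ t' x with hu
  have hu_old : ∀ d : M.toFinGraph.Dir, u (T.old d).1 =
      (∑ i, t i - ∑ i, t' i) * ℓ d.1 - T.amount r d - T.amount r (rev d) := by
    intro d
    simp only [hu, T.foldLength_old, hamount, ← hc, ← hc']
    field_simp
    simp only [hc, hc']
    ring
  have hu_new : ∀ i, u (Sum.inr i) = r i := by
    intro i
    simp only [hu, hr, foldLength, ← hc, ← hc']
    field_simp
  have hzero : ∀ x, lengthFunction (M.fold T).marking u x = 0 := by
    intro x
    have h1 : lengthFunction (M.fold T).marking u x =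
        c' * c * foldedLengthFunction M T ℓ t x - c' * c * foldedLengthFunction M T ℓ t' x :=
      wordLength_lincomb _ _ _ _ _
    rw [h1, h, sub_self]
  obtain ⟨D, hrev, hturn⟩ : ∃ D : T.foldGraph.Dir → ℝ, (∀ x, D x + D (rev x) = 2 * u x.1) ∧
      ∀ x y, init x = init y → x ≠ y → D x + D y = 0 := exists_halfEdge_weights (M.fold T) hzero
  have hnone : ∀ x : M.toFinGraph.Dir, (∀ i, init x ≠ init (T.a i)) → T.index x = none := by
    intro x hx
    rw [Option.eq_none_iff_forall_ne_some]
    exact fun j hj => hx j (T.init_eq_of_index hj)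
  -- Adding `2 * amount r` moves the weights from the folded graph back to the original one: it
  -- restores the pieces cut off each edge. At a turn vertex the two folded directions get `2 * r i`
  -- and the third one, seen across the new edge, has `-(2 * r i)`; hence the absolute value.
  refine ⟨fun x => D (T.old x) + 2 * T.amount r x, fun x => ?_, fun x y hx hxy hne => ?_,
    fun i x hx => ?_⟩
  · have h1 := hrev (T.old x)
    rw [hu_old, T.rev_old] at h1
    linarith
  · have hy : ∀ i, init y ≠ init (T.a i) := fun i => hxy ▸ hx i
    have h1 := hturn (T.old x) (T.old y) (by
      rw [T.init_old, T.init_old, T.foldInit_of_none (hnone x hx), T.foldInit_of_none (hnone y hy),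
        hxy]) fun e => hne (T.old_injective e)
    simp only [T.amount_of_none (hnone x hx), T.amount_of_none (hnone y hy)]
    linarith
  · have ha : init (T.old (T.a i)) = Sum.inr i := by
      rw [T.init_old, T.foldInit_of_some (T.index_a i)]
    have hb : init (T.old (T.b i)) = Sum.inr i := by
      rw [T.init_old, T.foldInit_of_some (T.index_b i)]
    have hn : init (rev (T.new i)) = Sum.inr i := rfl
    have hab := hturn _ _ (ha.trans hb.symm) fun e => T.ne i (T.old_injective e)
    have han := hturn _ _ (ha.trans hn.symm) (T.old_ne_rev_new _ i)
    have hbn := hturn _ _ (hb.trans hn.symm) (T.old_ne_rev_new _ i)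
    have hnew := hrev (T.new i)
    have hnew' : u (T.new i).1 = r i := hu_new i
    rw [hnew'] at hnew
    by_cases hxi : T.index x = some i
    · have h1 : D (T.old x) = 0 := by
        rcases T.index_eq_some.1 hxi with rfl | rfl <;> linarith
      simp only [h1, T.amount_of_some hxi, zero_add, abs_mul, abs_two]
    · have hxn : T.index x = none := by
        rw [Option.eq_none_iff_forall_ne_some]
        intro j hj
        obtain rfl : i = j := T.init_injective (hx.symm.trans (T.init_eq_of_index hj))
        exact hxi hj
      have h1 := hturn (T.old x) (T.new i)
        (by rw [T.init_old, T.foldInit_of_none hxn, T.init_new, hx]) (T.old_ne_new _ i)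
      have h2 : D (T.old x) = -(2 * r i) := by linarith
      simp only [h2, T.amount_of_none hxn, mul_zero, add_zero, abs_neg, abs_mul, abs_two]

theorem eq_of_foldedLengthFunction_eq_of_topIncident (hℓ : ∀ e, 0 < ℓ e) (ht : ∑ i, t i < 1)
    (ht' : ∑ i, t' i < 1) (h : foldedLengthFunction M T ℓ t = foldedLengthFunction M T ℓ t')
    {e₀ : M.E} (he₀ : ∀ i, ¬ TopIncident e₀ (init (T.a i))) : t = t' := by
  obtain ⟨D, hD⟩ := exists_balanced ht ht' h
  funext i
  have hκ := hD.kappa_eq_zero M.connected M.valence_ne_one hℓ i he₀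
  rw [hκ] at hD
  obtain ⟨d, -, hd⟩ := hD.exists_eq_zero M.connected M.valence_ne_one i he₀ true
  have hr := hD.eq_zero M.connected hd i
  have hs : ∑ i, t' i = ∑ i, t i := by linarith
  rw [hs, ← mul_sub] at hr
  rcases mul_eq_zero.1 hr with h0 | h0 <;> linarith

/-- Equal sums give `κ = 0`, and the common coordinate `i₀` provides the zero of `D`. -/
theorem eq_of_foldedLengthFunction_eq_of_slice (ht : ∑ i, t i < 1)
    (h : foldedLengthFunction M T ℓ t = foldedLengthFunction M T ℓ t')
    (hs : ∑ i, t' i = ∑ i, t i) {i₀ : Fin n} (hi₀ : t i₀ = t' i₀) : t = t' := by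
  obtain ⟨D, hD⟩ := exists_balanced ht (hs.trans_lt ht) h
  rw [hs, sub_self] at hD
  have hz : D (T.a i₀) = 0 := by
    have := hD.abs_eq i₀ (T.a i₀) rfl
    rw [hi₀, sub_self, abs_zero, mul_zero] at this
    exact abs_eq_zero.1 this
  funext i
  have hr := hD.eq_zero M.connected hz i
  rw [← mul_sub] at hr
  rcases mul_eq_zero.1 hr with h0 | h0 <;> linarith

end Injectivity

open Filter

/-! ### Embedded boxes -/

section Boxes

theorem exists_isEmbedding_range_eq_box {m : ℕ} {lo hi : ℝ} (h : lo < hi) :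
    ∃ g : EuclideanSpace ℝ (Fin m) → Fin m → ℝ, IsEmbedding g ∧
      Set.range g = {s | ∀ j, lo < s j ∧ s j < hi} := by
  set q : ℝ → ℝ := fun x => lo + (hi - lo) * Real.sigmoid x with hq
  have hrange : Set.range q = Set.Ioo lo hi := by
    ext y
    constructor
    · rintro ⟨x, rfl⟩
      have h1 := Real.sigmoid_pos x
      have h2 := Real.sigmoid_lt_one x
      constructor <;> simp only [hq] <;> nlinarith
    · rintro ⟨h1, h2⟩
      have h3 : (y - lo) / (hi - lo) ∈ Set.range Real.sigmoid := by
        rw [Real.range_sigmoid]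
        exact ⟨div_pos (by linarith) (by linarith), (div_lt_one (by linarith)).2 (by linarith)⟩
      obtain ⟨x, hx⟩ := h3
      refine ⟨x, ?_⟩
      simp only [hq, hx]
      rw [mul_div_cancel₀ _ (by linarith)]
      ring
  have hqe : IsEmbedding q := by
    refine StrictMono.isEmbedding_of_ordConnected (fun x y hxy => ?_)
      (hrange ▸ Set.ordConnected_Ioo)
    have := Real.sigmoid_strictMono hxy
    simp only [hq]
    nlinarith
  refine ⟨(Pi.map fun _ => q) ∘ PiLp.homeomorph 2 fun _ => ℝ,
    (IsEmbedding.piMap fun _ => hqe).comp (Homeomorph.isEmbedding _), ?_⟩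
  rw [Set.range_comp, (PiLp.homeomorph 2 fun _ : Fin m => ℝ).surjective.range_eq, Set.image_univ,
    Set.range_piMap, hrange]
  ext s
  simp [Set.mem_pi]

/-- An injective continuous map on a compact box restricts to an embedding of the open box. -/
theorem exists_isEmbedding_of_box {X : Type*} [TopologicalSpace X] [T2Space X] {m : ℕ} {lo hi : ℝ}
    (h : lo < hi) {Φ : (Fin m → ℝ) → X}
    (hc : ContinuousOn Φ (Set.Icc (fun _ => lo) fun _ => hi))
    (hinj : Set.InjOn Φ (Set.Icc (fun _ => lo) fun _ => hi)) :
    ∃ g : EuclideanSpace ℝ (Fin m) → Fin m → ℝ, IsEmbedding (Φ ∘ g) ∧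
      Set.range g = {s | ∀ j, lo < s j ∧ s j < hi} := by
  obtain ⟨g, hg, hrange⟩ := exists_isEmbedding_range_eq_box (m := m) h
  have hmem : ∀ x, g x ∈ Set.Icc (fun _ => lo) fun _ => hi := fun x => by
    have hx : g x ∈ Set.range g := ⟨x, rfl⟩
    rw [hrange] at hx
    exact ⟨fun j => (hx j).1.le, fun j => (hx j).2.le⟩
  -- A continuous injection from a compact space into a Hausdorff space is a closed embedding.
  have h1 : IsEmbedding ((Set.Icc (fun _ => lo) fun _ => hi).domRestrict Φ) :=
    (hc.domRestrict.isClosedEmbedding (Set.injOn_iff_injective.1 hinj)).isEmbedding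
  exact ⟨g, h1.comp (hg.codRestrict _ hmem), hrange⟩

end Boxes

/-- The topology of outer space is the length function topology. -/
theorem isEmbedding_outerSpace {N : ℕ} : IsEmbedding fun Y : OuterSpace N => Y.1 :=
  IsEmbedding.subtypeVal

/-! ### The folded metric graphs as points of outer space -/

section FoldedPoints

variable {N n : ℕ} {M : MarkedGraph N} {T : TurnFamily M.toFinGraph n} {ℓ : M.E → ℝ}

theorem continuousOn_wordLength {A : Type*} [TopologicalSpace A] {S : Set A}
    {E : Type} {w : A → E → ℝ} (hw : ∀ e, ContinuousOn (fun t => w t e) S)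
    (p : List (E × Bool)) : ContinuousOn (fun t => wordLength (w t) p) S := by
  induction p with
  | nil => simpa using continuousOn_const
  | cons d p ih => simp only [wordLength_cons]; exact (hw d.1).add ih

theorem continuousOn_foldedLengthFunction :
    ContinuousOn (foldedLengthFunction M T ℓ) {t | ∑ i, t i < 1} := by
  refine continuousOn_pi.2 fun x => continuousOn_wordLength (w := foldLength T.a T.b ℓ) ?_ _
  have hne : ∀ t ∈ {t : Fin n → ℝ | ∑ i, t i < 1}, 1 - ∑ i, t i ≠ 0 := fun t ht => by
    have : ∑ i, t i < 1 := ht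
    linarith
  have hden : Continuous fun t : Fin n → ℝ => 1 - ∑ i, t i := by fun_prop
  rintro (e | i)
  · refine ContinuousOn.div (Continuous.continuousOn ?_) hden.continuousOn hne
    refine continuous_const.sub (continuous_finsetSum _ fun i _ => ?_)
    refine Continuous.add ?_ ?_ <;> split_ifs <;> fun_prop
  · exact ContinuousOn.div (continuous_apply i).continuousOn hden.continuousOn hne

/-- At `t = 0` the new edges have length zero, so the folded weights are only a degenerate metric.
Neither `fold` nor `collapse` increases length and `collapse` undoes `fold`, so reduced lengths
agree. -/
theorem foldedLengthFunction_zero (hℓ : ∀ e, 0 ≤ ℓ e) :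
    foldedLengthFunction M T ℓ 0 = lengthFunction M.marking ℓ := by
  set w := foldLength T.a T.b ℓ 0 with hw
  have hw_inl : ∀ e, w (Sum.inl e) = ℓ e := fun e => by simp [hw, foldLength]
  have hw_inr : ∀ i, w (Sum.inr i) = 0 := fun i => by simp [hw, foldLength]
  have hw0 : ∀ x, 0 ≤ w x := by
    rintro (e | i)
    · rw [hw_inl]; exact hℓ e
    · rw [hw_inr]
  have key : ∀ g : FreeGroup M.E,
      wordLength w (T.fold.onFree g).toWord = wordLength ℓ g.toWord := by
    intro g
    refine le_antisymm ?_ ?_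
    · have h1 : T.fold.onFree g = FreeGroup.mk (T.fold.onPath g.toWord) := by
        rw [← PathMap.onFree_mk, FreeGroup.mk_toWord]
      rw [h1, FreeGroup.toWord_mk]
      refine (wordLength_reduce_le hw0 _).trans_eq ?_
      rw [PathMap.onPath, wordLength_flatMap ℓ _ _ _ (T.wordLength_fold_onDir ℓ 0)]
      simp
    · have h1 : g = FreeGroup.mk (T.collapse.onPath (T.fold.onFree g).toWord) := by
        rw [← PathMap.onFree_mk, FreeGroup.mk_toWord, T.collapse_onFree_fold]
      nth_rewrite 1 [h1]
      rw [FreeGroup.toWord_mk]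
      refine (wordLength_reduce_le hℓ _).trans_eq ?_
      rw [PathMap.onPath, wordLength_flatMap w ℓ 1, one_mul]
      rintro ⟨e | i, b⟩
      · simp [TurnFamily.collapse, hw_inl]
      · simp [TurnFamily.collapse, hw_inr]
  funext x
  change translationLength w (foldHom T.a T.b (M.marking x)) = translationLength ℓ (M.marking x)
  refine translationLength_eq_of_bounded (C := 0) fun k => ?_
  rw [T.foldHom_eq, ← map_pow, key, sub_self, abs_zero]

/-- The folded graph with its metric, as a point of outer space. -/
noncomputable def foldPoint (T : TurnFamily M.toFinGraph n) {δ : ℝ} (hδ : 0 < δ)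
    (hℓ : ∀ e, 2 * δ ≤ ℓ e) (hvol : ∑ e, ℓ e = 1) {t : Fin n → ℝ} (ht : ∀ i, 0 < t i ∧ t i < δ)
    (hsum : ∑ i, t i < 1) : OuterSpace N :=
  ⟨foldedLengthFunction M T ℓ t, M.fold T, foldLength T.a T.b ℓ t, T.foldLength_pos hδ hℓ ht hsum,
    T.sum_foldLength hvol hsum, rfl⟩

end FoldedPoints

/-! ### Folded graphs in the axis bundle -/

section Density

/-- No edge is longer than one, so lengths of prefixes approximate any `τ` from below with error at
most one. -/
theorem exists_prefix_wordLength {E : Type} {w : E → ℝ} (hw : ∀ e, w e ≤ 1)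
    {Q : List (E × Bool)} {τ : ℝ} (h0 : 0 ≤ τ) (h1 : τ ≤ wordLength w Q) :
    ∃ P, P <+: Q ∧ wordLength w P ≤ τ ∧ τ ≤ wordLength w P + 1 := by
  induction Q generalizing τ with
  | nil =>
    refine ⟨[], List.prefix_rfl, h0, ?_⟩
    rw [wordLength_nil] at h1 ⊢
    linarith
  | cons d Q ih =>
    by_cases hd : τ < w d.1
    · exact ⟨[], List.nil_prefix, h0, by rw [wordLength_nil]; linarith [hw d.1]⟩
    · rw [wordLength_cons] at h1
      obtain ⟨P, hP, h2, h3⟩ := ih (τ := τ - w d.1) (by linarith) (by linarith)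
      refine ⟨d :: P, (List.prefix_cons_inj d).2 hP, ?_, ?_⟩ <;> rw [wordLength_cons] <;> linarith

variable {N : ℕ} {M : MarkedGraph N} {f : GraphMap M.toFinGraph} {ℓ : M.E → ℝ} {lam : ℝ}

theorem FinGraph.GraphMap.wordLength_onPath_iterate (h : f.transitionMatrix.mulVec ℓ = lam • ℓ) (k : ℕ)
    (p : List M.toFinGraph.Dir) : wordLength ℓ (f.onPath^[k] p) = lam ^ k * wordLength ℓ p := by
  have h1 : ∀ d, wordLength ℓ (f.onDir d) = lam * ℓ d.1 := by
    have h2 : ∀ e, wordLength ℓ (f.onE e) = lam * ℓ e := fun e => by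
      rw [← f.transitionMatrix_mulVec, h]; rfl
    rintro ⟨e, _ | _⟩
    · exact (wordLength_invRev _ _).trans (h2 e)
    · exact h2 e
  induction k with
  | zero => simp
  | succ k ih =>
    rw [Function.iterate_succ_apply', GraphMap.onPath, wordLength_flatMap ℓ ℓ lam _ h1, ih]
    ring

theorem FinGraph.GraphMap.IsTrainTrack.isReduced_iterate (h : f.IsTrainTrack) (k : ℕ)
    (d : M.toFinGraph.Dir) : FreeGroup.IsReduced (f.onPath^[k] [d]) := by
  rcases Nat.eq_zero_or_pos k with rfl | hk
  · exact FreeGroup.IsReduced.singleton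
  · obtain ⟨e, _ | _⟩ := d
    · have h1 : f.onPath^[k] [(e, false)] = FreeGroup.invRev (f.onPath^[k] [(e, true)]) := by
        rw [← f.toPathMap_onPath, ← PathMap.iterate_onDir, ← PathMap.iterate_onDir]
        exact PathMap.onDir_rev _ (e, true)
      rw [h1, FreeGroup.isReduced_iff_reduce_eq, FreeGroup.reduce_invRev, (h.2 k e hk).reduce_eq]
    · exact h.2 k e hk

theorem FinGraph.GraphMap.IsTrainTrack.exists_iterate_eq_cons (h : f.IsTrainTrack) (k : ℕ)
    (d : M.toFinGraph.Dir) : ∃ q, f.onPath^[k] [d] = f.derivDir^[k] d :: q := by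
  have hne : ∀ d, f.onDir d ≠ [] := by
    rintro ⟨e, _ | _⟩
    · intro h1
      have h2 : FreeGroup.invRev (f.onE e) = [] := h1
      exact h.1 e (by simpa using congrArg FreeGroup.invRev h2)
    · exact h.1 e
  induction k with
  | zero => exact ⟨[], rfl⟩
  | succ k ih =>
    obtain ⟨q, hq⟩ := ih
    rw [Function.iterate_succ_apply', hq, Function.iterate_succ_apply']
    obtain ⟨x, r, hx⟩ := List.exists_cons_of_ne_nil (hne (f.derivDir^[k] d))
    refine ⟨r ++ f.onPath q, ?_⟩
    change f.onDir _ ++ f.onPath q = (f.onDir _).headD _ :: _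
    rw [hx]
    rfl

/-- The images of the two directions of an illegal turn have long common prefixes. -/
theorem FinGraph.GraphMap.IllegalTurn.exists_common_prefix (htt : f.IsTrainTrack)
    (hℓ : ∀ e, 0 < ℓ e) (hlam : 1 < lam) (hmat : f.transitionMatrix.mulVec ℓ = lam • ℓ)
    {a b : M.toFinGraph.Dir} (h : f.IllegalTurn a b) : ∃ η > 0, ∃ k₀ : ℕ, ∀ k ≥ k₀, ∃ Q,
      Q <+: f.onPath^[k] [a] ∧ Q <+: f.onPath^[k] [b] ∧ lam ^ k * η ≤ wordLength ℓ Q := by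
  obtain ⟨-, -, k₀, -, hk₀⟩ := h
  have hlam0 : 0 < lam := by linarith
  -- After `k₀` steps the two images share their first edge; its image under the remaining `k - k₀`
  -- steps is the common prefix.
  refine ⟨ℓ (f.derivDir^[k₀] a).1 / lam ^ k₀, div_pos (hℓ _) (pow_pos hlam0 _), k₀,
    fun k hk => ⟨f.onPath^[k - k₀] [f.derivDir^[k₀] a], ?_, ?_, ?_⟩⟩
  · obtain ⟨q, hq⟩ := htt.exists_iterate_eq_cons k₀ a
    conv_rhs => rw [← Nat.sub_add_cancel hk, Function.iterate_add_apply, hq]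
    rw [← f.toPathMap_onPath, ← PathMap.iterate_onPath, ← PathMap.iterate_onPath,
      PathMap.onPath_cons, PathMap.onPath_cons, PathMap.onPath_nil, List.append_nil]
    exact List.prefix_append _ _
  · obtain ⟨q, hq⟩ := htt.exists_iterate_eq_cons k₀ b
    conv_rhs => rw [← Nat.sub_add_cancel hk, Function.iterate_add_apply, hq]
    rw [hk₀, ← f.toPathMap_onPath, ← PathMap.iterate_onPath, ← PathMap.iterate_onPath,
      PathMap.onPath_cons, PathMap.onPath_cons, PathMap.onPath_nil, List.append_nil]
    exact List.prefix_append _ _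
  · rw [GraphMap.wordLength_onPath_iterate hmat, wordLength_cons, wordLength_nil, add_zero]
    refine le_of_eq ?_
    conv_lhs => rw [← Nat.sub_add_cancel hk, pow_add]
    field_simp

variable {n : ℕ} {T : TurnFamily M.toFinGraph n} {φ : MulAut (FreeGroup (Fin N))}

/-- Folding by lengths such that the endpoints of the folded segments are mapped to vertices leads
into `TT (φ ^ k)`, and such lengths are dense. -/
theorem exists_near_mem_TT (hrep : Represents M f φ) (htt : f.IsTrainTrack)
    (hlam : 1 < lam) (hmat : f.transitionMatrix.mulVec ℓ = lam • ℓ) {δ : ℝ} (hδ : 0 < δ)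
    (hℓ : ∀ e, 2 * δ ≤ ℓ e) (hvol : ∑ e, ℓ e = 1) {t : Fin n → ℝ} (ht : ∀ i, 0 < t i ∧ t i < δ)
    (hsum : ∑ i, t i < 1) {k : ℕ} (hk : k ≠ 0) (hkt : ∀ i, 1 < lam ^ k * t i)
    (hQ : ∀ i, ∃ Q, Q <+: f.onPath^[k] [T.a i] ∧ Q <+: f.onPath^[k] [T.b i] ∧
      lam ^ k * t i ≤ wordLength ℓ Q) :
    ∃ Y ∈ TT (φ ^ k), ∃ s, Y.1 = foldedLengthFunction M T ℓ s ∧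
      ∀ i, t i - (lam ^ k)⁻¹ ≤ s i ∧ s i ≤ t i := by
  have hpos : ∀ e, 0 < ℓ e := fun e => by linarith [hℓ e]
  have hle1 : ∀ e, ℓ e ≤ 1 := fun e =>
    hvol ▸ Finset.single_le_sum (fun e _ => (hpos e).le) (Finset.mem_univ e)
  have hlamk : 0 < lam ^ k := pow_pos (by linarith) k
  choose Q hQa hQb hQℓ using hQ
  have hP := fun i => exists_prefix_wordLength hle1 (mul_pos hlamk (ht i).1).le (hQℓ i)
  choose P hPQ hP1 hP2 using hP
  -- The initial segment that `f^k` maps exactly across `P i`. The error of at most one in the image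
  -- shrinks to `(lam ^ k)⁻¹`.
  set s : Fin n → ℝ := fun i => wordLength ℓ (P i) / lam ^ k with hs
  have hs1 : ∀ i, s i ≤ t i := fun i => (div_le_iff₀' hlamk).2 (hP1 i)
  have hs2 : ∀ i, t i - (lam ^ k)⁻¹ ≤ s i := fun i => by
    rw [hs, sub_le_iff_le_add, ← one_div, ← add_div, le_div_iff₀' hlamk]
    exact hP2 i
  have hs0 : ∀ i, 0 < s i ∧ s i < δ := fun i =>
    ⟨div_pos (by linarith [hkt i, hP2 i]) hlamk, (hs1 i).trans_lt (ht i).2⟩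
  have hssum : ∑ i, s i < 1 := (Finset.sum_le_sum fun i _ => hs1 i).trans_lt hsum
  have hFn : (f.toPathMap.iterate k).onPath = f.onPath^[k] :=
    funext fun p => PathMap.iterate_onPath _ _ _
  have hFd : ∀ d, (f.toPathMap.iterate k).onDir d = f.onPath^[k] [d] :=
    fun d => PathMap.iterate_onDir _ _ _
  refine ⟨foldPoint T hδ hℓ hvol hs0 hssum, mem_TT_of_prefixes (F := f.toPathMap.iterate k) (P := P)
    (hrep.iterate k) (fun m d => ?_) hδ hℓ hvol (one_lt_pow₀ hlam hk) (fun d => ?_) hs0 hssum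
    (fun i => ?_) (fun i => ?_) (fun i => ?_) rfl, s, rfl, fun i => ⟨hs2 i, hs1 i⟩⟩
  · rw [hFn, ← Function.iterate_mul]
    exact htt.isReduced_iterate _ d
  · rw [hFd, GraphMap.wordLength_onPath_iterate hmat, wordLength_cons, wordLength_nil, add_zero]
  · rw [hFd]; exact (hPQ i).trans (hQa i)
  · rw [hFd]; exact (hPQ i).trans (hQb i)
  · simp only [hs]; field_simp

theorem exists_fold_mem_axisBundle (hrep : Represents M f φ) (htt : f.IsTrainTrack)
    (hlam : 1 < lam) (hmat : f.transitionMatrix.mulVec ℓ = lam • ℓ) {δ : ℝ} (hδ : 0 < δ)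
    (hℓ : ∀ e, 2 * δ ≤ ℓ e) (hvol : ∑ e, ℓ e = 1) (hill : ∀ i, f.IllegalTurn (T.a i) (T.b i)) :
    ∃ ε > 0, ∀ t : Fin n → ℝ, (∀ i, 0 < t i ∧ t i < ε) → ∑ i, t i < 1 →
      ∃ Y ∈ axisBundle φ, Y.1 = foldedLengthFunction M T ℓ t := by
  have hpos : ∀ e, 0 < ℓ e := fun e => by linarith [hℓ e]
  have h1 := fun i => (hill i).exists_common_prefix htt hpos hlam hmat
  choose η hη k₀ hQ using h1
  -- With `ε ≤ η i` the length `lam ^ k * t i` does not exceed that of the common prefix, for every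
  -- large `k`.
  obtain ⟨ε, hε, hεη⟩ : ∃ ε > 0, ε ≤ δ ∧ ∀ i, ε ≤ η i := by
    have h2 : ∀ᶠ ε in 𝓝[>] (0 : ℝ), ε ≤ δ ∧ ∀ i, ε ≤ η i :=
      nhdsWithin_le_nhds ((eventually_le_nhds hδ).and
        (eventually_all.2 fun i => eventually_le_nhds (hη i)))
    obtain ⟨ε, hε⟩ := (h2.and self_mem_nhdsWithin).exists
    exact ⟨ε, hε.2, hε.1⟩
  refine ⟨ε, hε, fun t ht hsum => ?_⟩
  have htδ : ∀ i, 0 < t i ∧ t i < δ := fun i => ⟨(ht i).1, (ht i).2.trans_le hεη.1⟩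
  have hev : ∀ᶠ k : ℕ in atTop, (∀ i, 1 < lam ^ k * t i) ∧ (∀ i, k₀ i ≤ k) ∧ k ≠ 0 :=
    (eventually_all.2 fun i => ((tendsto_pow_atTop_atTop_of_one_lt hlam).atTop_mul_const
      (ht i).1).eventually_gt_atTop 1).and
      ((eventually_all.2 fun i => eventually_ge_atTop (k₀ i)).and (eventually_ne_atTop 0))
  obtain ⟨K, hK⟩ := eventually_atTop.1 hev
  have happrox : ∀ k : ℕ, ∃ Y ∈ TT (φ ^ (K + k)), ∃ s, Y.1 = foldedLengthFunction M T ℓ s ∧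
      ∀ i, t i - (lam ^ (K + k))⁻¹ ≤ s i ∧ s i ≤ t i := by
    intro k
    obtain ⟨hk1, hk2, hk3⟩ := hK (K + k) (Nat.le_add_right _ _)
    refine exists_near_mem_TT hrep htt hlam hmat hδ hℓ hvol htδ hsum hk3 hk1 fun i => ?_
    obtain ⟨Q, hQa, hQb, hQℓ⟩ := hQ i (K + k) (hk2 i)
    refine ⟨Q, hQa, hQb, le_trans ?_ hQℓ⟩
    exact mul_le_mul_of_nonneg_left ((ht i).2.le.trans (hεη.2 i)) (pow_pos (by linarith) _).le
  choose Y hY s hYs hs using happrox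
  refine ⟨foldPoint T hδ hℓ hvol htδ hsum, ?_, rfl⟩
  refine mem_closure_of_tendsto (f := Y) (b := atTop) ?_ (Eventually.of_forall fun k =>
    Set.mem_iUnion₂.2 ⟨K + k, by have := (hK (K + k) (Nat.le_add_right _ _)).2.2; omega, hY k⟩)
  have hst : Tendsto s atTop (𝓝 t) := by
    refine tendsto_pi_nhds.2 fun i => ?_
    have hinv : Tendsto (fun k : ℕ => t i - (lam ^ (K + k))⁻¹) atTop (𝓝 (t i)) := by
      have h2 := (tendsto_pow_atTop_atTop_of_one_lt hlam).inv_tendsto_atTop.comp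
        (tendsto_add_atTop_nat K)
      have h3 : Tendsto (fun k : ℕ => (lam ^ (K + k))⁻¹) atTop (𝓝 0) :=
        h2.congr fun k => by simp [add_comm]
      simpa using tendsto_const_nhds.sub h3
    exact tendsto_of_tendsto_of_tendsto_of_le_of_le hinv tendsto_const_nhds
      (fun k => (hs k i).1) fun k => (hs k i).2
  have hopen : IsOpen {t : Fin n → ℝ | ∑ i, t i < 1} :=
    isOpen_lt (by fun_prop) continuous_const
  have hcont : Tendsto (fun k => foldedLengthFunction M T ℓ (s k)) atTop
      (𝓝 (foldedLengthFunction M T ℓ t)) :=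
    ((continuousOn_foldedLengthFunction (M := M) (T := T) (ℓ := ℓ)).continuousAt
      (hopen.mem_nhds hsum)).tendsto.comp hst
  exact isEmbedding_outerSpace.isInducing.tendsto_nhds_iff.2 (hcont.congr fun k => (hYs k).symm)

end Density

/-! ### Copies of Euclidean space in the axis bundle -/

section LocalDimension

variable {N n : ℕ} {φ : MulAut (FreeGroup (Fin N))} {M : MarkedGraph N}
  {f : GraphMap M.toFinGraph} {ℓ : M.E → ℝ} {T : TurnFamily M.toFinGraph n}

theorem exists_pos_two_mul_le {E : Type*} [Finite E] {ℓ : E → ℝ} (hℓ : ∀ e, 0 < ℓ e) :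
    ∃ δ > 0, ∀ e, 2 * δ ≤ ℓ e := by
  have h : ∀ᶠ δ in 𝓝[>] (0 : ℝ), ∀ e, δ ≤ ℓ e / 2 :=
    nhdsWithin_le_nhds (eventually_all.2 fun e => eventually_le_nhds (half_pos (hℓ e)))
  obtain ⟨δ, h1, h2⟩ := (h.and self_mem_nhdsWithin).exists
  exact ⟨δ, h2, fun e => by linarith [h1 e]⟩

/-- Sufficiently small folds lead to points of the axis bundle near the original graph. -/
theorem exists_radius (hrep : Represents M f φ) (htt : f.IsTrainTrack)
    (hℓ : f.IsExpandingEigenmetric ℓ) (hill : ∀ i, f.IllegalTurn (T.a i) (T.b i))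
    {U : Set (OuterSpace N)} (hU : U ∈ 𝓝 (M.point ℓ hℓ.1 hℓ.2.1)) :
    ∃ ε > 0, (∀ t : Fin n → ℝ, (∀ i, 0 ≤ t i ∧ t i ≤ ε) → ∑ i, t i < 1) ∧
      ∀ t : Fin n → ℝ, (∀ i, 0 < t i ∧ t i < ε) →
        ∃ Y ∈ U ∩ axisBundle φ, Y.1 = foldedLengthFunction M T ℓ t := by
  obtain ⟨hpos, hvol, lam, hlam, hmat⟩ := id hℓ
  obtain ⟨δ, hδ, hδℓ⟩ := exists_pos_two_mul_le hpos
  obtain ⟨ε₁, hε₁, hA⟩ := exists_fold_mem_axisBundle hrep htt hlam hmat hδ hδℓ hvol hill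
  rw [isEmbedding_outerSpace.isInducing.nhds_eq_comap] at hU
  obtain ⟨V, hV, hVU⟩ := hU
  have hopen : IsOpen {t : Fin n → ℝ | ∑ i, t i < 1} :=
    isOpen_lt (by fun_prop) continuous_const
  have h0 : (0 : Fin n → ℝ) ∈ {t : Fin n → ℝ | ∑ i, t i < 1} := by simp
  have hcont := (continuousOn_foldedLengthFunction (M := M) (T := T) (ℓ := ℓ)).continuousAt
    (hopen.mem_nhds h0)
  have hV' : V ∈ 𝓝 (foldedLengthFunction M T ℓ 0) := by
    rw [foldedLengthFunction_zero fun e => (hpos e).le]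
    exact hV
  obtain ⟨ρ, hρ, hball⟩ := Metric.mem_nhds_iff.1 (Filter.inter_mem (hcont hV') (hopen.mem_nhds h0))
  -- Half the radius leaves room for the closed box, whose compactness is used for the embedding.
  have hsub : ∀ t : Fin n → ℝ, (∀ i, 0 ≤ t i ∧ t i ≤ ρ / 2) →
      foldedLengthFunction M T ℓ t ∈ V ∧ ∑ i, t i < 1 := fun t ht => hball <| by
    rw [Metric.mem_ball, dist_pi_lt_iff hρ]
    intro i
    rw [Pi.zero_apply, Real.dist_eq, sub_zero, abs_of_nonneg (ht i).1]
    linarith [(ht i).2]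
  refine ⟨min ε₁ (ρ / 2), lt_min hε₁ (half_pos hρ), fun t ht =>
    (hsub t fun i => ⟨(ht i).1, (ht i).2.trans (min_le_right _ _)⟩).2, fun t ht => ?_⟩
  obtain ⟨h1, h2⟩ := hsub t fun i => ⟨(ht i).1.le, (ht i).2.le.trans (min_le_right _ _)⟩
  obtain ⟨Y, hY, hYt⟩ := hA t (fun i => ⟨(ht i).1, (ht i).2.trans_le (min_le_left _ _)⟩) h2
  refine ⟨Y, ⟨hVU ?_, hY⟩, hYt⟩
  change Y.1 ∈ V
  rwa [hYt]

/-- A box of folding lengths on which the folded graphs are distinct gives a copy of `ℝ^m`. -/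
theorem exists_isEmbedding_of_folds {A : Set (OuterSpace N)} {ε : ℝ}
    (hsum : ∀ t : Fin n → ℝ, (∀ i, 0 ≤ t i ∧ t i ≤ ε) → ∑ i, t i < 1)
    (hA : ∀ t : Fin n → ℝ, (∀ i, 0 < t i ∧ t i < ε) →
      ∃ Y ∈ A, Y.1 = foldedLengthFunction M T ℓ t)
    {m : ℕ} {lo hi : ℝ} (hlh : lo < hi) {τ : (Fin m → ℝ) → Fin n → ℝ} (hτ : Continuous τ)
    (hclosed : ∀ s, (∀ j, lo ≤ s j ∧ s j ≤ hi) → ∀ i, 0 ≤ τ s i ∧ τ s i ≤ ε)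
    (hopen : ∀ s, (∀ j, lo < s j ∧ s j < hi) → ∀ i, 0 < τ s i ∧ τ s i < ε)
    (hinj : ∀ s s', (∀ i, 0 ≤ τ s i ∧ τ s i ≤ ε) → (∀ i, 0 ≤ τ s' i ∧ τ s' i ≤ ε) →
      foldedLengthFunction M T ℓ (τ s) = foldedLengthFunction M T ℓ (τ s') → s = s') :
    ∃ h : EuclideanSpace ℝ (Fin m) → OuterSpace N, IsEmbedding h ∧ Set.range h ⊆ A ∧
      Set.range h = {Y | ∃ s, (∀ j, lo < s j ∧ s j < hi) ∧
        Y.1 = foldedLengthFunction M T ℓ (τ s)} := by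
  have hbox : ∀ s ∈ Set.Icc (fun _ : Fin m => lo) fun _ => hi, ∀ i, 0 ≤ τ s i ∧ τ s i ≤ ε :=
    fun s hs => hclosed s fun j => ⟨hs.1 j, hs.2 j⟩
  obtain ⟨g, hg, hrange⟩ := exists_isEmbedding_of_box (Φ := foldedLengthFunction M T ℓ ∘ τ) hlh
    (continuousOn_foldedLengthFunction.comp hτ.continuousOn fun s hs => hsum _ (hbox s hs))
    (fun s hs s' hs' h => hinj s s' (hbox s hs) (hbox s' hs') h)
  have hgmem : ∀ x, ∀ j, lo < g x j ∧ g x j < hi := fun x => by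
    have hx : g x ∈ Set.range g := ⟨x, rfl⟩
    rw [hrange] at hx
    exact hx
  choose h hhA hh using fun x => hA (τ (g x)) (hopen _ (hgmem x))
  refine ⟨h, isEmbedding_outerSpace.of_comp_iff.1 ?_, ?_, ?_⟩
  · convert hg using 1
    exact funext hh
  · rintro _ ⟨x, rfl⟩
    exact hhA x
  · ext Y
    constructor
    · rintro ⟨x, rfl⟩
      exact ⟨g x, hgmem x, hh x⟩
    · rintro ⟨s, hs, hY⟩
      obtain ⟨x, rfl⟩ : s ∈ Set.range g := hrange ▸ hs
      exact ⟨x, Subtype.ext ((hh x).trans hY.symm)⟩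

/-- A parametrization of the slice of a box in which the first coordinate and the sum of all
coordinates are fixed. -/
noncomputable def slice (ε : ℝ) {m : ℕ} (y : Fin m → ℝ) : Fin (m + 2) → ℝ :=
  Fin.cons (ε / 2) (Fin.cons (ε / 2 - ∑ j, y j) fun j => ε / 2 + y j)

theorem continuous_slice (ε : ℝ) (m : ℕ) : Continuous (slice ε (m := m)) := by
  refine continuous_pi fun i => ?_
  refine Fin.cases ?_ (fun i => Fin.cases ?_ (fun j => ?_) i) i <;>
    simp only [slice, Fin.cons_zero, Fin.cons_succ] <;> fun_prop

theorem slice_injective (ε : ℝ) (m : ℕ) : Function.Injective (slice ε (m := m)) := by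
  intro y y' h
  funext j
  have := congrFun h j.succ.succ
  simp only [slice, Fin.cons_succ] at this
  linarith

theorem sum_slice (ε : ℝ) {m : ℕ} (y : Fin m → ℝ) : ∑ i, slice ε y i = (m + 2) * (ε / 2) := by
  simp only [slice, Fin.sum_univ_succ, Fin.cons_zero, Fin.cons_succ, Finset.sum_add_distrib,
    Finset.sum_const, Finset.card_univ, Fintype.card_fin, nsmul_eq_mul]
  ring

theorem slice_mem {ε : ℝ} (hε : 0 < ε) {m : ℕ} {y : Fin m → ℝ}
    (hy : ∀ j, -(ε / (4 * (m + 1))) ≤ y j ∧ y j ≤ ε / (4 * (m + 1))) (i : Fin (m + 2)) :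
    0 < slice ε y i ∧ slice ε y i < ε := by
  -- With this bound on each `y j`, both `|y j|` and `|∑ y j|` are at most `ε / 4`, so all
  -- coordinates stay within `ε / 4` of `ε / 2`.
  set η := ε / (4 * ((m : ℝ) + 1)) with hη
  have hηε : (m + 1) * η = ε / 4 := by rw [hη]; field_simp
  have hη0 : 0 < η := by positivity
  have hη4 : η ≤ ε / 4 := by
    rw [← hηε]
    nlinarith [(Nat.cast_nonneg m : (0 : ℝ) ≤ m)]
  have hsum : |∑ j, y j| ≤ m * η := by
    refine (Finset.abs_sum_le_sum_abs _ _).trans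
      ((Finset.sum_le_sum fun j _ => abs_le.2 (hy j)).trans_eq ?_)
    simp
  have hsum' := abs_le.1 hsum
  refine Fin.cases ?_ (fun i => Fin.cases ?_ (fun j => ?_) i) i <;>
    simp only [slice, Fin.cons_zero, Fin.cons_succ]
  · constructor <;> linarith
  · constructor <;> linarith [hsum'.1, hsum'.2]
  · constructor <;> linarith [(hy j).1, (hy j).2]

theorem localDimAtLeast_sub_two (hrep : Represents M f φ) (htt : f.IsTrainTrack)
    (hℓ : f.IsExpandingEigenmetric ℓ) (hill : ∀ i, f.IllegalTurn (T.a i) (T.b i)) :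
    LocalDimAtLeast (axisBundle φ) (M.point ℓ hℓ.1 hℓ.2.1) (n - 2) := by
  intro U hU
  obtain ⟨ε, hε, hsum, hA⟩ := exists_radius hrep htt hℓ hill hU
  by_cases hn : n < 2
  -- Here `n - 2` is truncated to zero, and a single nearby point of the axis bundle suffices.
  · obtain ⟨Y, hY, -⟩ := hA (fun _ => ε / 2) fun _ => ⟨half_pos hε, half_lt_self hε⟩
    rw [Nat.sub_eq_zero_of_le hn.le]
    exact ⟨fun _ => Y, IsEmbedding.of_subsingleton _, by rintro _ ⟨_, rfl⟩; exact hY⟩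
  · obtain ⟨m, rfl⟩ := Nat.exists_eq_add_of_le' (not_lt.1 hn)
    rw [Nat.add_sub_cancel]
    obtain ⟨h, he, hr, -⟩ := exists_isEmbedding_of_folds (lo := -(ε / (4 * ((m : ℝ) + 1))))
      (hi := ε / (4 * ((m : ℝ) + 1))) hsum hA (neg_lt_self (by positivity)) (continuous_slice ε m)
      (fun s hs i => ⟨(slice_mem hε hs i).1.le, (slice_mem hε hs i).2.le⟩)
      (fun s hs i => slice_mem hε (fun j => ⟨(hs j).1.le, (hs j).2.le⟩) i)
      (fun s s' hs _ h => slice_injective ε m (eq_of_foldedLengthFunction_eq_of_slice (hsum _ hs) h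
        (by rw [sum_slice, sum_slice]) (i₀ := 0) rfl))
    exact ⟨h, he, hr⟩

theorem exists_isEmbedding_range_eq_folds (hrep : Represents M f φ) (htt : f.IsTrainTrack)
    (hℓ : f.IsExpandingEigenmetric ℓ) (hill : ∀ i, f.IllegalTurn (T.a i) (T.b i))
    {e₀ : M.E} (he₀ : ∀ i, ¬ TopIncident e₀ (init (T.a i)))
    {U : Set (OuterSpace N)} (hU : U ∈ 𝓝 (M.point ℓ hℓ.1 hℓ.2.1)) :
    ∃ ε : ℝ, 0 < ε ∧ ∃ h : EuclideanSpace ℝ (Fin n) → OuterSpace N, IsEmbedding h ∧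
      Set.range h ⊆ U ∩ axisBundle φ ∧
      Set.range h = {Y | ∃ t : Fin n → ℝ, (∀ i, 0 < t i ∧ t i < ε) ∧
        IsSimultaneousFold M ℓ T.a T.b t Y} := by
  obtain ⟨ε, hε, hsum, hA⟩ := exists_radius hrep htt hℓ hill hU
  exact ⟨ε, hε, exists_isEmbedding_of_folds (τ := id) hsum hA hε continuous_id (fun _ hs => hs)
    (fun _ hs => hs) fun s s' hs hs' h =>
      eq_of_foldedLengthFunction_eq_of_topIncident hℓ.1 (hsum s hs) (hsum s' hs') h he₀⟩

end LocalDimension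

end AxisBundle

open AxisBundle AxisBundle.FinGraph in
theorem lemma3p4 {N : ℕ} (φ : MulAut (FreeGroup (Fin N))) (M : MarkedGraph N)
    (f : GraphMap M.toFinGraph) (hrep : Represents M f φ) (htt : f.IsTrainTrack)
    (hirr : f.transitionMatrix.IsIrreducible)
    (ℓ : M.E → ℝ) (hℓ : f.IsExpandingEigenmetric ℓ)
    (n : ℕ) (v : Fin n → M.V) (hv : Function.Injective v)
    (hval : ∀ i, M.toFinGraph.valence (v i) = 3)
    (a b : Fin n → M.toFinGraph.Dir) (ha : ∀ i, init (a i) = v i)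
    (hill : ∀ i, f.IllegalTurn (a i) (b i)) :
    ((∃ e₀ : M.E, ∀ i, ¬ TopIncident e₀ (v i)) →
      (∀ U ∈ 𝓝 (M.point ℓ hℓ.1 hℓ.2.1), ∃ ε : ℝ, 0 < ε ∧
        ∃ h : EuclideanSpace ℝ (Fin n) → OuterSpace N, IsEmbedding h ∧
          Set.range h ⊆ U ∩ axisBundle φ ∧
          Set.range h = {Y | ∃ t : Fin n → ℝ, (∀ i, 0 < t i ∧ t i < ε) ∧
            IsSimultaneousFold M ℓ a b t Y}) ∧
      LocalDimAtLeast (axisBundle φ) (M.point ℓ hℓ.1 hℓ.2.1) n) ∧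
    LocalDimAtLeast (axisBundle φ) (M.point ℓ hℓ.1 hℓ.2.1) (n - 2) := by
  let T : TurnFamily M.toFinGraph n :=
    { a := a
      b := b
      init_b := fun i => (hill i).1.symm
      ne := fun i => (hill i).2.1
      init_injective := by simpa only [ha] using hv
      valence_eq := fun i => by rw [ha]; exact hval i }
  have hinit : ∀ i, init (T.a i) = v i := ha
  have hfold : (∃ e₀ : M.E, ∀ i, ¬ TopIncident e₀ (v i)) →
      ∀ U ∈ 𝓝 (M.point ℓ hℓ.1 hℓ.2.1), ∃ ε : ℝ, 0 < ε ∧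
        ∃ h : EuclideanSpace ℝ (Fin n) → OuterSpace N, IsEmbedding h ∧
          Set.range h ⊆ U ∩ axisBundle φ ∧
          Set.range h = {Y | ∃ t : Fin n → ℝ, (∀ i, 0 < t i ∧ t i < ε) ∧
            IsSimultaneousFold M ℓ a b t Y} := by
    rintro ⟨e₀, he₀⟩ U hU
    exact exists_isEmbedding_range_eq_folds (T := T) hrep htt hℓ hill
      (fun i => (hinit i).symm ▸ he₀ i) hU
  refine ⟨fun he => ⟨hfold he, fun U hU => ?_⟩, localDimAtLeast_sub_two (T := T) hrep htt hℓ hill⟩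
  obtain ⟨-, -, h, hemb, hrange, -⟩ := hfold he U hU
  exact ⟨h, hemb, hrange⟩
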